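/- Let $d\ge 1$, and let $p$ be a probability density on $\mathbb R^d$ with $\|p\|_\infty\le L$ for some $0<L<\infty$. Write $\|\cdot\|$ for the $L_2(\mathbb R^d)$ norm, let $X_1,\dots,X_n$ be i.i.d. with density $p$, and for an estimator $T$ based on $n$ observations put $R_n(T,p)=E_p^n\|T-p\|^2$. Let $K\in L_2(\mathbb R^d)$ be a real-valued kernel such that a version of its Fourier transform $\mathcal F[K]$ (normalized as $t\mapsto\int e^{ix^Tt}K(x)\,dx$) takes values in $[0,1]$ and satisfies $\mathcal F[K](h't)\ge\mathcal F[K](ht)$ for all $t\in\mathbb R^d$ and $h>h'>0$. Let $$\hat p_{n,h}(x)=\frac1{nh^d}\sum_{i=1}^nK\Big(\frac{X_i-x}{h}\Big),\qquad h>0 .$$ *The kernel aggregate.* Fix $a_0>0$. For $n\ge3$ put $h_0=(n\log n)^{-1/d}$, $a_n=a_0/\log n$, $M-2=\max\{j\in\mathbb N: h_0(1+a_n)^j<1\}$, $h_j=(1+a_n)^jh_0$ for $0\le j\le M-2$ and $h_{M-1}=1$; $m=\lfloor n(1-1/\log n)\rfloor$ and $\ell=n-m$. Let $\mathbf S=\mathbf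 S_n$ be an arbitrary non-empty finite set of splits of the sample into a training subsample of size $m$ and a validation subsample $Y_1,\dots,Y_\ell$ of size $\ell$. For each split let $p_j=\hat p_{m,h_{j-1}}$, $j=1,\dots,M$, be the kernel estimators built from the training subsample, and let $\tilde p_n^{\mathcal S}$ be either, for all $n$ and all splits, the linear aggregate $$\sum_{k=1}^{M'}\Big(\frac1\ell\sum_{i=1}^\ell\phi_k(Y_i)\Big)\phi_k ,$$ where $\phi_1,\dots,\phi_{M'}$ is an orthonormal basis in $L_2(\mathbb R^d)$ of the linear span of $p_1,\dots,p_M$ (chosen from the training subsample), or, for all $n$ and all splits, the convex aggregate $\sum_j\hat\lambda_jp_j$, where $\hat\lambda$ is any minimizer of $\big\|\sum_j\lambda_jp_j\big\|^2-\frac2\ell\sum_{i=1}^\ell\sum_j\lambda_jp_j(Y_i)$ over $\{\lambda\in\mathbb R^M:\lambda_j\ge0,\ \sum_j\lambda_j\le1\}$; the choices are made measurably. Let $\tilde p_n^{\mathbf S,K}=\frac1{\mathrm{card}(\mathbf S)}\sum_{\mathcal S\in\mathbf S}\tilde p_n^{\mathcal S}$. *Claim.* Suppose that for some $c>0$ and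 $\alpha>0$ $$\inf_{h>0}R_n(\hat p_{n,h},p)\ge c\,n^{-1+\alpha}$$ for all sufficiently large $n$. Then $$R_n(\tilde p_n^{\mathbf S,K},p)\le\inf_{h>0}R_n(\hat p_{n,h},p)\,(1+o(1)),\qquad n\to\infty .$$ -/

import Mathlib

open MeasureTheory Filter Topology FourierTransform
open scoped ENNReal NNReal

noncomputable section

namespace KernelAgg

/-- The sample space `ℝ^d`. -/
abbrev Pt (d : ℕ) : Type := EuclideanSpace ℝ (Fin d)

/-- `p` is a probability density on `ℝ^d` (with respect to Lebesgue measure). -/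
structure IsDensity {d : ℕ} (p : Pt d → ℝ) : Prop where
  nonneg : ∀ x, 0 ≤ p x
  integrable : Integrable p volume
  integral_eq_one : ∫ x, p x = 1

/-- The law `P_p^n` of an i.i.d. sample of size `n` with common density `p`. -/
def sampleLaw {d : ℕ} (p : Pt d → ℝ) (n : ℕ) : Measure (Fin n → Pt d) :=
  Measure.pi fun _ => (volume : Measure (Pt d)).withDensity fun x => ENNReal.ofReal (p x)

/-- The `L₂`-risk `R_n(T, p) = E_p^n ‖T - p‖²` of an estimator `T` based on `n` observations,
with values in `[0, ∞]`. -/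
def risk {d n : ℕ} (T : (Fin n → Pt d) → Pt d → ℝ) (p : Pt d → ℝ) : ℝ≥0∞ :=
  ∫⁻ X, (∫⁻ x, ENNReal.ofReal ((T X x - p x) ^ 2)) ∂(sampleLaw p n)

/-- The kernel density estimator with kernel `K` and bandwidth `h` based on the sample `X`. -/
def kde {d n : ℕ} (K : Pt d → ℝ) (h : ℝ) (X : Fin n → Pt d) (x : Pt d) : ℝ :=
  (1 / ((n : ℝ) * h ^ d)) * ∑ i, K (h⁻¹ • (X i - x))

/-- The kernel oracle risk `inf_{h > 0} R_n(p̂_{n,h}, p)`. -/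
def oracleRisk {d : ℕ} (K p : Pt d → ℝ) (n : ℕ) : ℝ≥0∞ :=
  ⨅ h : Set.Ioi (0 : ℝ), risk (fun X : Fin n → Pt d => kde K h X) p

/-- `Φ` is a version (a representative modulo null sets) of the Fourier transform of `K ∈ L₂(ℝ^d)`
in the normalization `t ↦ ∫ exp(i xᵀt) K(x) dx`. Mathlib's `𝓕` on `L₂` is normalized as
`ξ ↦ ∫ exp(-2πi xᵀξ) K(x) dx`, so it has to be evaluated at `ξ = -t / (2π)`. -/
def IsFourierVersion {d : ℕ} (K : Pt d → ℝ) (hK : MemLp K 2 volume) (Φ : Pt d → ℝ) : Prop :=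
  (fun t => (Φ t : ℂ)) =ᵐ[volume]
    fun t => (𝓕 ((hK.ofReal (K := ℂ)).toLp _) : Lp ℂ 2 (volume : Measure (Pt d)))
      ((-(2 * Real.pi)⁻¹ : ℝ) • t)

/-- `φ_1, …, φ_r` is an orthonormal basis, in `L₂(ℝ^d)`, of the linear span of
`p_1, …, p_M`. -/
structure IsOrthonormalBasisOfSpan {d M r : ℕ} (p : Fin M → Pt d → ℝ)
    (φ : Fin r → Pt d → ℝ) : Prop where
  memLp : ∀ k, MemLp (φ k) 2 volume
  orthonormal : ∀ k k', ∫ x, φ k x * φ k' x = if k = k' then 1 else 0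
  mem_span : ∀ k, ∃ c : Fin M → ℝ, φ k =ᵐ[volume] fun x => ∑ j, c j * p j x
  span_le : ∀ j, ∃ b : Fin r → ℝ, p j =ᵐ[volume] fun x => ∑ k, b k * φ k x

/-- `T` is a linear aggregate of the fixed functions `p_1, …, p_M`, based on a sample `Y` of size
`l`: the empirical projection on an orthonormal basis of their span. -/
def IsLinearAggregate {d M l : ℕ} (p : Fin M → Pt d → ℝ)
    (T : (Fin l → Pt d) → Pt d → ℝ) : Prop :=
  ∃ (r : ℕ) (φ : Fin r → Pt d → ℝ), IsOrthonormalBasisOfSpan p φ ∧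
    ∀ Y x, T Y x = ∑ k, ((1 / (l : ℝ)) * ∑ i, φ k (Y i)) * φ k x

/-- The simplex `{λ : λ_j ≥ 0, ∑ λ_j ≤ 1}`. -/
def simplex (M : ℕ) : Set (Fin M → ℝ) := {w | (∀ j, 0 ≤ w j) ∧ ∑ j, w j ≤ 1}

/-- The empirical criterion `‖p_λ‖² - (2/l) ∑ p_λ(Y_i)`, where `p_λ = ∑ λ_j p_j`. -/
def empCriterion {d M l : ℕ} (p : Fin M → Pt d → ℝ) (Y : Fin l → Pt d) (w : Fin M → ℝ) : ℝ :=
  (∫ x, (∑ j, w j * p j x) ^ 2) - (2 / (l : ℝ)) * ∑ i, ∑ j, w j * p j (Y i)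

/-- `T` is a convex aggregate of the fixed functions `p_1, …, p_M`, based on a sample `Y` of size
`l`: the combination whose weights minimize the empirical criterion over the simplex (any
minimizer may be used). -/
def IsConvexAggregate {d M l : ℕ} (p : Fin M → Pt d → ℝ)
    (T : (Fin l → Pt d) → Pt d → ℝ) : Prop :=
  ∃ w : (Fin l → Pt d) → Fin M → ℝ,
    (∀ Y, w Y ∈ simplex M ∧ IsMinOn (empCriterion p Y) (simplex M) (w Y)) ∧
    ∀ Y x, T Y x = ∑ j, w Y j * p j x

/-- The two kinds of aggregation. -/
inductive Kind
  | linear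
  | convex

/-- Aggregates of fixed functions, of either kind. -/
def IsAggregate {d M l : ℕ} : Kind → (Fin M → Pt d → ℝ) → ((Fin l → Pt d) → Pt d → ℝ) → Prop
  | .linear => IsLinearAggregate
  | .convex => IsConvexAggregate

/-- The smallest bandwidth `h_0 = (n log n)^{-1/d}`. -/
def minBandwidth (d n : ℕ) : ℝ := ((n : ℝ) * Real.log n) ^ (-(1 / (d : ℝ)))

/-- The step `a_n = a_0 / log n` of the grid. -/
def gridStep (a₀ : ℝ) (n : ℕ) : ℝ := a₀ / Real.log n

/-- The number of bandwidths `M`, with `M - 2 = max {j : h_0 (1 + a_n)^j < 1}`. -/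
def gridSize (d : ℕ) (a₀ : ℝ) (n : ℕ) : ℕ :=
  sSup {j : ℕ | minBandwidth d n * (1 + gridStep a₀ n) ^ j < 1} + 2

/-- The bandwidths `h_j = (1 + a_n)^j h_0` for `0 ≤ j ≤ M - 2`, and `h_{M-1} = 1`. -/
def bandwidth (d : ℕ) (a₀ : ℝ) (n : ℕ) (j : Fin (gridSize d a₀ n)) : ℝ :=
  if (j : ℕ) + 1 = gridSize d a₀ n then 1
  else (1 + gridStep a₀ n) ^ (j : ℕ) * minBandwidth d n

/-- The size `m = ⌊n (1 - 1 / log n)⌋` of the training sample. -/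
def trainSize (n : ℕ) : ℕ := ⌊(n : ℝ) * (1 - (Real.log n)⁻¹)⌋₊

/-- The size `l = n - m` of the validation sample. -/
def validSize (n : ℕ) : ℕ := n - trainSize n

/-- A split of a sample of size `n` into a training sample of size `m` and a validation sample of
size `l`: a bijection from the positions in the two subsamples to the positions in the sample. -/
abbrev Split (n : ℕ) : Type := Fin (trainSize n) ⊕ Fin (validSize n) ≃ Fin n

/-- The training sample of a split. -/
def Split.train {d n : ℕ} (S : Split n) (X : Fin n → Pt d) : Fin (trainSize n) → Pt d :=
  fun i => X (S (Sum.inl i))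

/-- The validation sample of a split. -/
def Split.valid {d n : ℕ} (S : Split n) (X : Fin n → Pt d) : Fin (validSize n) → Pt d :=
  fun i => X (S (Sum.inr i))

/-- `T` is a linear or convex kernel aggregate for one split, as a function of the training sample
`U` and the validation sample `V`: for every (frozen) training sample `U`, the map `T U` is an
aggregate of the kernel estimators `p̂_{m,h}` built from `U`, with `h` in the grid; and `T` is an
estimator, i.e. `T U V x` is a measurable function of `(U, V, x)` (up to null sets). -/
structure IsSplitAggregate {d : ℕ} (kind : Kind) (K p : Pt d → ℝ) (a₀ : ℝ) (n : ℕ)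
    (T : (Fin (trainSize n) → Pt d) → (Fin (validSize n) → Pt d) → Pt d → ℝ) : Prop where
  isAggregate : ∀ U, IsAggregate kind
    (fun j : Fin (gridSize d a₀ n) => kde K (bandwidth d a₀ n j) U) (T U)
  aemeasurable : AEMeasurable
    (fun q : ((Fin (trainSize n) → Pt d) × (Fin (validSize n) → Pt d)) × Pt d =>
      T q.1.1 q.1.2 q.2)
    (((sampleLaw p (trainSize n)).prod (sampleLaw p (validSize n))).prod volume)

/-- The average, over a finite set `𝒮` of splits, of the estimators `T S` attached to the splits. -/
def averaged {d n : ℕ} (𝒮 : Finset (Split n))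
    (T : Split n → (Fin (trainSize n) → Pt d) → (Fin (validSize n) → Pt d) → Pt d → ℝ)
    (X : Fin n → Pt d) (x : Pt d) : ℝ :=
  (1 / (𝒮.card : ℝ)) * ∑ S ∈ 𝒮, T S (S.train X) (S.valid X) x

end KernelAgg

end

/-! The risk of a kernel estimator has a closed form. By Tonelli and the bias-variance decomposition
at each point, followed by Plancherel, it equals B(h) + (‖K‖² h^(-d) - S(h)) / n. Here B(h) = ∫ (1 -
Ψ(hξ))² |𝓕p(ξ)|² dξ, S(h) = ∫ Ψ(hξ)² |𝓕p(ξ)|² dξ, and Ψ is the transform of K in the 2π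
normalization. Since Ψ takes values in [0, 1] and decreases along rays, B increases with h, S
decreases with h, and both are at most ‖p‖².

This formula makes the grid as good as all h > 0. Moving h ∈ [h₀, 1) down to the grid costs a factor
(1 + a_n)^d and O(1/n). For h ≥ 1 the bandwidth 1 is as good up to ‖K‖²/n. For h < h₀ the variance
is at least of order log n, so that the bandwidth 1 wins for large n. Training on m instead of n
points costs a factor n/m → 1.

Aggregation adds little. Conditionally on the training sample the estimators are fixed functions. In
an orthonormal basis of their span, both aggregates have loss at most that of any single estimator
plus the squared error of the empirical coefficients. There are at most M coefficients, each of
variance at most L/ℓ, which gives a remainder LM/ℓ. Averaging over splits is harmless by convexity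
of the square. As M = O(log² n) and ℓ ≥ n / log n, the remainder is O(log³ n / n), which is
negligible against c n^(-1+α) and hence against the oracle risk.

The main steps are `corr_plancherel`, `risk_kde`, `IsAggregate.lintegral_le`, `risk_averaged_le` and
`Assumptions.eventually_exists_bandwidth`. -/

noncomputable section

namespace KernelAgg

/-! ### Fourier transform on L¹ ∩ L² and Plancherel for kernel smoothing -/

section Fourier

variable {E : Type*} [NormedAddCommGroup E] [InnerProductSpace ℝ E] [FiniteDimensional ℝ E]
  [MeasurableSpace E] [BorelSpace E]

theorem continuous_fourier_of_integrable {f : E → ℂ} (hf : Integrable f) : Continuous (𝓕 f) :=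
  VectorFourier.fourierIntegral_continuous Real.continuous_fourierChar
    continuous_inner hf

theorem integral_mul_fourier_eq {f g : E → ℂ} (hf : Integrable f) (hg : Integrable g) :
    ∫ ξ, 𝓕 f ξ * g ξ = ∫ x, f x * 𝓕 g x := by
  have h := VectorFourier.integral_fourierIntegral_smul_eq_flip (L := innerₗ E) (μ := volume)
    (ν := volume) Real.continuous_fourierChar continuous_inner hf hg
  rw [flip_innerₗ] at h
  exact h

/-- On `L¹ ∩ L²`, the `L²` Fourier transform is given by the Fourier integral. -/
theorem fourier_toLp_ae_eq {f : E → ℂ} (hf : Integrable f) (hf2 : MemLp f 2 volume) :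
    (𝓕 (hf2.toLp f) : Lp ℂ 2 (volume : Measure E)) =ᵐ[volume] 𝓕 f := by
  -- Both sides are locally integrable, so testing against smooth compactly supported functions
  -- suffices. The transform moves onto the test function by duality for tempered distributions on
  -- one side and by Fubini on the other.
  refine ae_eq_of_integral_contDiff_smul_eq
    ((Lp.memLp _).locallyIntegrable (by norm_num))
    (continuous_fourier_of_integrable hf).locallyIntegrable ?_
  intro g g_smooth g_cpt
  have hg₁ : HasCompactSupport (Complex.ofRealCLM ∘ g) := g_cpt.comp_left rfl
  have hg₂ : ContDiff ℝ ((⊤ : ℕ∞) : WithTop ℕ∞) (Complex.ofRealCLM ∘ g) := by fun_prop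
  set G := hg₁.toSchwartzMap hg₂ with hG
  have hGa : ∀ x, G x = (g x : ℂ) := fun x => rfl
  have h1 := congrArg (fun D => D G) (Lp.fourier_toTemperedDistribution_eq (hf2.toLp f))
  simp only [TemperedDistribution.fourier_apply, Lp.toTemperedDistribution_apply] at h1
  calc ∫ x, g x • (𝓕 (hf2.toLp f) : Lp ℂ 2 (volume : Measure E)) x
      = ∫ x, G x • (𝓕 (hf2.toLp f) : Lp ℂ 2 (volume : Measure E)) x := by
        simp [hGa]
    _ = ∫ x, (𝓕 G) x • (hf2.toLp f) x := h1.symm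
    _ = ∫ x, 𝓕 (G : E → ℂ) x * f x := by
        apply integral_congr_ae
        filter_upwards [hf2.coeFn_toLp] with x hx
        rw [hx, SchwartzMap.fourier_coe, smul_eq_mul]
    _ = ∫ x, G x * 𝓕 f x := integral_mul_fourier_eq G.integrable hf
    _ = ∫ x, g x • 𝓕 f x := by simp [hGa]

theorem memLp_fourier {f : E → ℂ} (hf : Integrable f) (hf2 : MemLp f 2 volume) :
    MemLp (𝓕 f) 2 volume :=
  (memLp_congr_ae (fourier_toLp_ae_eq hf hf2)).1 (Lp.memLp _)

theorem memLp_fourierInv {f : E → ℂ} (hf : Integrable f) (hf2 : MemLp f 2 volume) :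
    MemLp (𝓕⁻ f) 2 volume := by
  rw [Real.fourierInv_eq_fourier_comp_neg]
  exact memLp_fourier hf.comp_neg
    (hf2.comp_measurePreserving (Measure.measurePreserving_neg volume))

/-- On `L¹ ∩ L²`, the inverse `L²` Fourier transform is given by the inverse Fourier integral. -/
theorem fourierInv_toLp_ae_eq {f : E → ℂ} (hf : Integrable f) (hf2 : MemLp f 2 volume) :
    (𝓕⁻ (hf2.toLp f) : Lp ℂ 2 (volume : Measure E)) =ᵐ[volume] 𝓕⁻ f := by
  have hc : Continuous (𝓕⁻ f) := by
    rw [Real.fourierInv_eq_fourier_comp_neg]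
    exact continuous_fourier_of_integrable hf.comp_neg
  refine ae_eq_of_integral_contDiff_smul_eq
    ((Lp.memLp _).locallyIntegrable (by norm_num)) hc.locallyIntegrable ?_
  intro g g_smooth g_cpt
  have hg₁ : HasCompactSupport (Complex.ofRealCLM ∘ g) := g_cpt.comp_left rfl
  have hg₂ : ContDiff ℝ ((⊤ : ℕ∞) : WithTop ℕ∞) (Complex.ofRealCLM ∘ g) := by fun_prop
  set G := hg₁.toSchwartzMap hg₂ with hG
  have hGa : ∀ x, G x = (g x : ℂ) := fun x => rfl
  have h1 := congrArg (fun D => D G) (Lp.fourierInv_toTemperedDistribution_eq (hf2.toLp f))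
  simp only [TemperedDistribution.fourierInv_apply, Lp.toTemperedDistribution_apply] at h1
  calc ∫ x, g x • (𝓕⁻ (hf2.toLp f) : Lp ℂ 2 (volume : Measure E)) x
      = ∫ x, G x • (𝓕⁻ (hf2.toLp f) : Lp ℂ 2 (volume : Measure E)) x := by
        simp [hGa]
    _ = ∫ x, (𝓕⁻ G) x • (hf2.toLp f) x := h1.symm
    _ = ∫ x, 𝓕 (G : E → ℂ) (-x) * f x := by
        apply integral_congr_ae
        filter_upwards [hf2.coeFn_toLp] with x hx
        rw [hx, SchwartzMap.fourierInv_coe, smul_eq_mul, Real.fourierInv_eq_fourier_neg]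
    _ = ∫ x, 𝓕 (G : E → ℂ) x * f (-x) := by
        rw [← integral_neg_eq_self]; simp
    _ = ∫ x, G x * 𝓕 (fun x => f (-x)) x := integral_mul_fourier_eq G.integrable hf.comp_neg
    _ = ∫ x, g x • 𝓕⁻ f x := by simp [hGa, Real.fourierInv_eq_fourier_comp_neg]

theorem integral_norm_sq_fourier {f : E → ℂ} (hf2 : MemLp f 2 volume) :
    ∫ x, ‖(𝓕 (hf2.toLp f) : Lp ℂ 2 (volume : Measure E)) x‖ ^ 2 = ∫ x, ‖f x‖ ^ 2 := by
  have h := Lp.inner_fourier_eq (hf2.toLp f) (hf2.toLp f)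
  rw [L2.inner_def, L2.inner_def] at h
  simp only [inner_self_eq_norm_sq_to_K] at h
  have h2 : ∫ x, ‖(hf2.toLp f) x‖ ^ 2 = ∫ x, ‖f x‖ ^ 2 := by
    apply integral_congr_ae
    filter_upwards [hf2.coeFn_toLp] with x hx
    rw [hx]
  rw [← h2]
  norm_cast at h

theorem integral_norm_sq_fourier_eq {f : E → ℂ} (hf : Integrable f) (hf2 : MemLp f 2 volume) :
    ∫ x, ‖𝓕 f x‖ ^ 2 = ∫ x, ‖f x‖ ^ 2 := by
  rw [← integral_norm_sq_fourier hf2]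
  apply integral_congr_ae
  filter_upwards [fourier_toLp_ae_eq hf hf2] with x hx
  rw [hx]

theorem fourier_comp_add (f : E → ℂ) (u ξ : E) :
    𝓕 (fun w => f (w + u)) ξ = (Real.fourierChar (inner ℝ u ξ) : ℂ) * 𝓕 f ξ := by
  have := congrFun (VectorFourier.fourierIntegral_comp_add_right Real.fourierChar volume
    (innerₗ E) f u) ξ
  exact this

theorem conj_fourier_ofReal (f : E → ℝ) (ξ : E) :
    (starRingEnd ℂ) (𝓕 (fun x => (f x : ℂ)) ξ) = 𝓕⁻ (fun x => (f x : ℂ)) ξ := by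
  rw [Real.fourier_eq, Real.fourierInv_eq, ← integral_conj]
  congr 1 with x
  simp [Circle.smul_def, Real.fourierChar_apply, ← Complex.exp_conj, map_ofNat]

/-- The function `u ↦ ∫ K(v - u) f(v) dv` is a Fourier integral. -/
theorem corr_eq_fourier {K f Ψ : E → ℝ} (hK : MemLp K 2 volume)
    (hΨ : (fun ξ => (Ψ ξ : ℂ)) =ᵐ[volume]
      (𝓕 ((hK.ofReal (K := ℂ)).toLp _) : Lp ℂ 2 (volume : Measure E)))
    (hf : Integrable f) (hf2 : MemLp f 2 volume) (u : E) :
    ((∫ v, K (v - u) * f v : ℝ) : ℂ) =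
      𝓕 (fun ξ => 𝓕⁻ (fun x => (f x : ℂ)) ξ * Ψ ξ) u := by
  -- `K` is only in L², so the integral is read as an L² pairing of `K` with a translate of `f`.
  -- Parseval then applies, and the translation becomes the phase of a Fourier integral in `u`.
  have hfu2 : MemLp (fun w => ((f (w + u) : ℝ) : ℂ)) 2 volume :=
    (hf2.comp_measurePreserving (measurePreserving_add_right volume u)).ofReal
  have hfu : Integrable (fun w => ((f (w + u) : ℝ) : ℂ)) := (hf.comp_add_right u).ofReal
  have h := Lp.inner_fourier_eq (hfu2.toLp _) ((hK.ofReal (K := ℂ)).toLp _)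
  rw [L2.inner_def, L2.inner_def] at h
  have hl : ∫ v, K (v - u) * f v = ∫ w, K w * f (w + u) := by
    rw [← integral_add_right_eq_self _ u]; simp
  rw [hl, ← integral_complex_ofReal]
  calc _ = ∫ x, inner ℂ ((hfu2.toLp _) x) (((hK.ofReal (K := ℂ)).toLp _) x) := by
        apply integral_congr_ae
        filter_upwards [hfu2.coeFn_toLp, (hK.ofReal (K := ℂ)).coeFn_toLp] with x h1 h2
        rw [h1, h2]
        simp
    _ = _ := h.symm
    _ = _ := by
        rw [Real.fourier_eq]
        apply integral_congr_ae
        filter_upwards [fourier_toLp_ae_eq hfu hfu2, hΨ] with x h1 h2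
        rw [h1, ← h2, fourier_comp_add (fun x => (f x : ℂ)), ← conj_fourier_ofReal]
        simp only [RCLike.inner_apply, map_mul, Circle.smul_def, smul_eq_mul,
          Real.fourierChar_apply, ← Complex.exp_conj]
        have : inner ℝ u x = inner ℝ x u := real_inner_comm _ _
        simp [this, map_ofNat]
        ring

theorem norm_fourierInv_ofReal (f : E → ℝ) (ξ : E) :
    ‖𝓕⁻ (fun x => (f x : ℂ)) ξ‖ = ‖𝓕 (fun x => (f x : ℂ)) ξ‖ := by
  rw [← conj_fourier_ofReal, RCLike.norm_conj]

theorem memLp_of_fourier_version {K Ψ : E → ℝ} (hK : MemLp K 2 volume)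
    (hΨ : (fun ξ => (Ψ ξ : ℂ)) =ᵐ[volume]
      (𝓕 ((hK.ofReal (K := ℂ)).toLp _) : Lp ℂ 2 (volume : Measure E))) :
    MemLp Ψ 2 volume := by
  have h : MemLp (fun ξ => (Ψ ξ : ℂ)) 2 volume := (memLp_congr_ae hΨ).2 (Lp.memLp _)
  exact h.re

/-- Plancherel for the smoothing operator `f ↦ ∫ K(v - ·) f(v) dv` and its residual. -/
theorem corr_plancherel {K f Ψ : E → ℝ} (hK : MemLp K 2 volume)
    (hΨ : (fun ξ => (Ψ ξ : ℂ)) =ᵐ[volume]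
      (𝓕 ((hK.ofReal (K := ℂ)).toLp _) : Lp ℂ 2 (volume : Measure E)))
    (hΨ01 : ∀ ξ, Ψ ξ ∈ Set.Icc (0 : ℝ) 1)
    (hf : Integrable f) (hf2 : MemLp f 2 volume) :
    MemLp (fun u => ∫ v, K (v - u) * f v) 2 volume ∧
    ∫ u, (∫ v, K (v - u) * f v) ^ 2 =
      ∫ ξ, Ψ ξ ^ 2 * ‖𝓕 (fun x => (f x : ℂ)) ξ‖ ^ 2 ∧
    ∫ u, ((∫ v, K (v - u) * f v) - f u) ^ 2 =
      ∫ ξ, (1 - Ψ ξ) ^ 2 * ‖𝓕 (fun x => (f x : ℂ)) ξ‖ ^ 2 := by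
  have hΨ2 := memLp_of_fourier_version hK hΨ
  have hfc : Integrable (fun x => (f x : ℂ)) := hf.ofReal
  have hfc2 : MemLp (fun x => (f x : ℂ)) 2 volume := hf2.ofReal
  have hI2 := memLp_fourierInv hfc hfc2
  have hΨc2 : MemLp (fun ξ => (Ψ ξ : ℂ)) 2 volume := hΨ2.ofReal
  -- `G` is integrable as a product of two L² functions, and square integrable because `Ψ` is
  -- bounded by 1. Hence its L² transform is the honest Fourier integral.
  set G : E → ℂ := fun ξ => 𝓕⁻ (fun x => (f x : ℂ)) ξ * Ψ ξ with hG
  have hG1 : Integrable G := hI2.integrable_mul hΨc2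
  have hG2 : MemLp G 2 volume := by
    refine hI2.mono hG1.aestronglyMeasurable (ae_of_all _ fun ξ => ?_)
    rw [hG, norm_mul]
    have := hΨ01 ξ
    refine mul_le_of_le_one_right (norm_nonneg _) ?_
    rw [Complex.norm_real, Real.norm_of_nonneg this.1]
    exact this.2
  set g : E → ℝ := fun u => ∫ v, K (v - u) * f v with hg
  have hgF : ∀ u, (g u : ℂ) = 𝓕 G u := fun u => corr_eq_fourier hK hΨ hf hf2 u
  have hgc2 : MemLp (fun u => (g u : ℂ)) 2 volume := by
    have := memLp_fourier hG1 hG2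
    rwa [← funext hgF] at this
  refine ⟨hgc2.re, ?_, ?_⟩
  · have h := integral_norm_sq_fourier_eq hG1 hG2
    simp only [← hgF] at h
    simp only [hG, norm_mul, Complex.norm_real, norm_fourierInv_ofReal, mul_pow,
      Real.norm_eq_abs, sq_abs] at h
    rw [h]
    simp only [mul_comm]
  -- Since `f` is the L² transform of its inverse transform, the residual is the transform of `G -
  -- 𝓕⁻ f`. As `𝓕⁻ f` need not be integrable, this is argued in L².
  · have h := integral_norm_sq_fourier (hG2.sub hI2)
    have hr : (𝓕 ((hG2.sub hI2).toLp _) : Lp ℂ 2 (volume : Measure E)) =ᵐ[volume]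
        fun u => ((g u - f u : ℝ) : ℂ) := by
      have e1 : (hI2.toLp _) = 𝓕⁻ (hfc2.toLp _) := by
        apply Lp.ext
        exact hI2.coeFn_toLp.trans (fourierInv_toLp_ae_eq hfc hfc2).symm
      have e2 : 𝓕 (hI2.toLp _) = hfc2.toLp _ := by
        rw [e1, FourierTransform.fourier_fourierInv_eq]
      have e3 : 𝓕 ((hG2.sub hI2).toLp _) = 𝓕 (hG2.toLp _) - hfc2.toLp _ := by
        rw [MemLp.toLp_sub, ← e2]
        exact (Lp.fourierTransformₗᵢ E ℂ).map_sub _ _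
      rw [e3]
      filter_upwards [Lp.coeFn_sub (𝓕 (hG2.toLp _)) (hfc2.toLp _), fourier_toLp_ae_eq hG1 hG2,
        hfc2.coeFn_toLp] with u h1 h2 h3
      rw [h1, Pi.sub_apply, h2, h3, ← hgF]
      push_cast
      rfl
    calc _ = ∫ x, ‖(𝓕 ((hG2.sub hI2).toLp _) : Lp ℂ 2 (volume : Measure E)) x‖ ^ 2 := by
          apply integral_congr_ae
          filter_upwards [hr] with u hu
          rw [hu, Complex.norm_real, Real.norm_eq_abs, sq_abs]
      _ = _ := h
      _ = _ := by
          congr 1 with ξ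
          have : (G - 𝓕⁻ (fun x => (f x : ℂ))) ξ
              = 𝓕⁻ (fun x => (f x : ℂ)) ξ * ((Ψ ξ - 1 : ℝ) : ℂ) := by
            simp [hG]; ring
          rw [this, norm_mul, norm_fourierInv_ofReal, Complex.norm_real, Real.norm_eq_abs, mul_pow,
            sq_abs]
          ring

end Fourier

/-! ### Dilations, and the mean of the kernel estimator -/

section Dilation

variable {E : Type*} [NormedAddCommGroup E] [InnerProductSpace ℝ E] [FiniteDimensional ℝ E]
  [MeasurableSpace E] [BorelSpace E]

theorem memLp_comp_smul {F : Type*} [NormedAddCommGroup F] {f : E → F} {q : ℝ≥0∞}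
    (hf : MemLp f q volume) {h : ℝ} (hh : h ≠ 0) : MemLp (fun x => f (h • x)) q volume := by
  have := (MeasurableEquiv.smul₀ (α := E) h hh).memLp_map_measure_iff (p := q) (g := f)
    (μ := volume)
  refine this.1 ?_
  have e : Measure.map (MeasurableEquiv.smul₀ (α := E) h hh) volume =
      ENNReal.ofReal |(h ^ Module.finrank ℝ E)⁻¹| • (volume : Measure E) :=
    Measure.map_addHaar_smul volume hh
  rw [e]
  exact hf.smul_measure ENNReal.ofReal_ne_top

theorem quasiMeasurePreserving_scaled_sub {h : ℝ} (hh : h ≠ 0) (y : E) :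
    Measure.QuasiMeasurePreserving (fun x : E => h • (y - x)) volume volume := by
  have h1 : Measure.QuasiMeasurePreserving (fun x : E => h • x) volume volume := by
    refine ⟨measurable_const_smul h, ?_⟩
    rw [Measure.map_addHaar_smul volume hh]
    exact Measure.smul_absolutelyContinuous
  exact h1.comp (Measure.measurePreserving_sub_left volume y).quasiMeasurePreserving

theorem memLp_scaled_sub {f : E → ℝ} (hf : MemLp f 2 volume) {h : ℝ} (hh : h ≠ 0) (y : E) :
    MemLp (fun x => f (h • (y - x))) 2 volume :=
  (memLp_comp_smul hf hh).comp_measurePreserving (Measure.measurePreserving_sub_left volume y)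

theorem memLp_scaled_sub_right {f : E → ℝ} (hf : MemLp f 2 volume) {h : ℝ} (hh : h ≠ 0) (y : E) :
    MemLp (fun x => f (h • (x - y))) 2 volume :=
  (memLp_comp_smul hf hh).comp_measurePreserving (measurePreserving_sub_right volume y)

theorem fourier_comp_smul (f : E → ℂ) {h : ℝ} (hh : 0 < h) (ξ : E) :
    𝓕 (fun v => f (h • v)) ξ = ((h ^ Module.finrank ℝ E)⁻¹ : ℝ) * 𝓕 f (h⁻¹ • ξ) := by
  have := Measure.integral_comp_smul_of_nonneg (volume : Measure E)
    (fun w => Real.fourierChar (-(inner ℝ w (h⁻¹ • ξ))) • f w) h (hR := hh.le)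
  rw [Real.fourier_eq, Real.fourier_eq, ← Complex.real_smul, ← this]
  congr 1 with v
  rw [real_inner_smul_left, real_inner_smul_right, mul_inv_cancel_left₀ hh.ne']

end Dilation

/-- The expectation of the kernel estimator. -/
def kernelMean {d : ℕ} (K : Pt d → ℝ) (h : ℝ) (p : Pt d → ℝ) (x : Pt d) : ℝ :=
  ∫ y, ((h ^ d)⁻¹ * K (h⁻¹ • (y - x))) * p y

/-- Substituting y = hv moves the bandwidth from the kernel to the density, so the Plancherel
identities for a fixed kernel apply to `p (h • ·)`. -/
theorem kernelMean_smul {d : ℕ} (K p : Pt d → ℝ) {h : ℝ} (hh : 0 < h) (u : Pt d) :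
    kernelMean K h p (h • u) = ∫ v, K (v - u) * p (h • v) := by
  have := Measure.integral_comp_smul_of_nonneg (volume : Measure (Pt d))
    (fun y => K (h⁻¹ • (y - h • u)) * p y) h (hR := hh.le)
  rw [finrank_euclideanSpace_fin] at this
  have e : ∀ v : Pt d, h⁻¹ • (h • v - h • u) = v - u := fun v => by
    rw [← smul_sub, inv_smul_smul₀ hh.ne']
  simp only [e] at this
  rw [this, kernelMean, smul_eq_mul, ← integral_const_mul]
  simp only [mul_assoc]

/-- Plancherel for the mean of the kernel estimator and its bias. -/
theorem kernelMean_plancherel {d : ℕ} {K p Ψ : Pt d → ℝ} (hK : MemLp K 2 volume)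
    (hΨ : (fun ξ => (Ψ ξ : ℂ)) =ᵐ[volume]
      (𝓕 ((hK.ofReal (K := ℂ)).toLp _) : Lp ℂ 2 (volume : Measure (Pt d))))
    (hΨ01 : ∀ ξ, Ψ ξ ∈ Set.Icc (0 : ℝ) 1)
    (hp : Integrable p) (hp2 : MemLp p 2 volume) {h : ℝ} (hh : 0 < h) :
    MemLp (kernelMean K h p) 2 volume ∧
    ∫ x, kernelMean K h p x ^ 2 =
      ∫ ξ, Ψ (h • ξ) ^ 2 * ‖𝓕 (fun x => (p x : ℂ)) ξ‖ ^ 2 ∧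
    ∫ x, (kernelMean K h p x - p x) ^ 2 =
      ∫ ξ, (1 - Ψ (h • ξ)) ^ 2 * ‖𝓕 (fun x => (p x : ℂ)) ξ‖ ^ 2 := by
  have hph : Integrable (fun v => p (h • v)) := hp.comp_smul hh.ne'
  have hph2 : MemLp (fun v => p (h • v)) 2 volume := memLp_comp_smul hp2 hh.ne'
  obtain ⟨h1, h2, h3⟩ := corr_plancherel hK hΨ hΨ01 hph hph2
  have hD : 0 < h ^ d := pow_pos hh d
  have hF : ∀ ξ, ‖𝓕 (fun x => ((p (h • x) : ℝ) : ℂ)) ξ‖ ^ 2 =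
      (h ^ d)⁻¹ ^ 2 * ‖𝓕 (fun x => (p x : ℂ)) (h⁻¹ • ξ)‖ ^ 2 := by
    intro ξ
    rw [fourier_comp_smul (fun x => (p x : ℂ)) hh, norm_mul, mul_pow, Complex.norm_real,
      finrank_euclideanSpace_fin, Real.norm_eq_abs, sq_abs]
  -- Undoing the dilation: the Jacobian h^d in space, the factor h^(-2d) from the squared transform
  -- and the Jacobian h^d in frequency cancel.
  have key : ∀ (a : Pt d → ℝ) (b : ℝ → ℝ),
      ∫ u, a (h • u) = ∫ ξ, b (Ψ ξ) * ‖𝓕 (fun x => ((p (h • x) : ℝ) : ℂ)) ξ‖ ^ 2 →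
      ∫ x, a x = ∫ ξ, b (Ψ (h • ξ)) * ‖𝓕 (fun x => (p x : ℂ)) ξ‖ ^ 2 := by
    intro a b hab
    have e1 := Measure.integral_comp_smul_of_nonneg (volume : Measure (Pt d)) a h (hR := hh.le)
    have e2 := Measure.integral_comp_smul_of_nonneg (volume : Measure (Pt d))
      (fun ξ => b (Ψ ξ) * ‖𝓕 (fun x => (p x : ℂ)) (h⁻¹ • ξ)‖ ^ 2) h (hR := hh.le)
    simp only [inv_smul_smul₀ hh.ne', finrank_euclideanSpace_fin, smul_eq_mul] at e1 e2
    rw [e2]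
    have e3 : ∫ x, a x = h ^ d * ∫ u, a (h • u) := by
      rw [e1, mul_inv_cancel_left₀ hD.ne']
    rw [e3, hab, ← integral_const_mul, ← integral_const_mul]
    congr 1 with ξ
    rw [hF]
    field_simp
  refine ⟨?_, key _ (fun s => s ^ 2) ?_, key _ (fun s => (1 - s) ^ 2) ?_⟩
  · have := memLp_comp_smul h1 (inv_ne_zero hh.ne')
    simp only [← kernelMean_smul K p hh, smul_inv_smul₀ hh.ne'] at this
    exact this
  · simp only [kernelMean_smul K p hh]
    exact h2
  · simp only [kernelMean_smul K p hh]
    exact h3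

/-! ### Bias and variance of a sample mean -/

section SampleMean

open ProbabilityTheory

variable {Ω : Type*} [MeasurableSpace Ω]

theorem memLp_sampleMean {μ : Measure Ω} [IsProbabilityMeasure μ] {Y : Ω → ℝ} (hY : MemLp Y 2 μ)
    (n : ℕ) :
    MemLp (fun X : Fin n → Ω => (1 / (n : ℝ)) * ∑ i, Y (X i)) 2 (Measure.pi fun _ => μ) := by
  refine MemLp.const_mul ?_ _
  exact memLp_finsetSum _ fun i _ =>
    hY.comp_measurePreserving (measurePreserving_eval (fun _ : Fin n => μ) i)

/-- Bias-variance decomposition of a sample mean. -/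
theorem integral_sampleMean_sub_sq {μ : Measure Ω} [IsProbabilityMeasure μ] {Y : Ω → ℝ}
    (hY : MemLp Y 2 μ) {n : ℕ} (hn : 0 < n) (a : ℝ) :
    ∫ X : Fin n → Ω, ((1 / (n : ℝ)) * ∑ i, Y (X i) - a) ^ 2 ∂(Measure.pi fun _ => μ) =
      (∫ y, Y y ∂μ - a) ^ 2 + (1 / (n : ℝ)) * (∫ y, Y y ^ 2 ∂μ - (∫ y, Y y ∂μ) ^ 2) := by
  have hn' : (n : ℝ) ≠ 0 := by positivity
  have hW := memLp_sampleMean hY n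
  set P : Measure (Fin n → Ω) := Measure.pi fun _ => μ
  set W : (Fin n → Ω) → ℝ := fun X => (1 / (n : ℝ)) * ∑ i, Y (X i) with hWdef
  have hmean : ∫ X, W X ∂P = ∫ y, Y y ∂μ := by
    rw [hWdef, integral_const_mul, integral_finsetSum]
    · have : ∀ i : Fin n, ∫ X : Fin n → Ω, Y (X i) ∂P = ∫ y, Y y ∂μ := fun i => by
        have e := (measurePreserving_eval (fun _ : Fin n => μ) i)
        have := integral_map (μ := P) (φ := Function.eval i) (f := Y) e.measurable.aemeasurable
          (by rw [e.map_eq]; exact hY.aestronglyMeasurable)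
        rw [e.map_eq] at this
        exact this.symm
      simp [this]
      field_simp
    · intro i _
      exact (hY.comp_measurePreserving
        (measurePreserving_eval (fun _ : Fin n => μ) i)).integrable (by norm_num)
  have hvar : Var[W; P] = (1 / (n : ℝ)) * (∫ y, Y y ^ 2 ∂μ - (∫ y, Y y ∂μ) ^ 2) := by
    have e1 : Var[W; P] = (1 / (n : ℝ)) ^ 2 * Var[∑ i : Fin n, fun X : Fin n → Ω => Y (X i); P] := by
      rw [← variance_const_mul]
      congr 1
      ext X
      simp [hWdef]
    rw [e1, variance_sum_pi (fun _ : Fin n => hY), Finset.sum_const, Finset.card_univ,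
      Fintype.card_fin, nsmul_eq_mul, variance_eq_sub hY]
    simp only [Pi.pow_apply]
    field_simp
  rw [← hvar, variance_eq_sub hW, hmean]
  simp only [Pi.pow_apply]
  have hW1 : Integrable W P := hW.integrable (by norm_num)
  have hW2 : Integrable (fun X => W X ^ 2) P := hW.integrable_sq
  have : ∀ X, (W X - a) ^ 2 = W X ^ 2 - (2 * a) * W X + a ^ 2 := fun X => by ring
  change ∫ X, (W X - a) ^ 2 ∂P = _
  simp only [this]
  have hI : Integrable (fun X => W X ^ 2 - (2 * a) * W X) P := hW2.sub (hW1.const_mul _)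
  rw [integral_add hI (integrable_const _),
    integral_sub hW2 (hW1.const_mul _), integral_const_mul, hmean]
  simp
  ring

theorem lintegral_sampleMean_sub_sq {μ : Measure Ω} [IsProbabilityMeasure μ] {Y : Ω → ℝ}
    (hY : MemLp Y 2 μ) {n : ℕ} (hn : 0 < n) (a : ℝ) :
    ∫⁻ X : Fin n → Ω, ENNReal.ofReal (((1 / (n : ℝ)) * ∑ i, Y (X i) - a) ^ 2)
        ∂(Measure.pi fun _ => μ) =
      ENNReal.ofReal ((∫ y, Y y ∂μ - a) ^ 2 +
        (1 / (n : ℝ)) * (∫ y, Y y ^ 2 ∂μ - (∫ y, Y y ∂μ) ^ 2)) := by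
  rw [← integral_sampleMean_sub_sq hY hn a]
  refine (ofReal_integral_eq_lintegral_ofReal ?_ (ae_of_all _ fun _ => sq_nonneg _)).symm
  exact ((memLp_sampleMean hY n).sub (memLp_const a)).integrable_sq

theorem sq_integral_le {μ : Measure Ω} [IsProbabilityMeasure μ] {Y : Ω → ℝ} (hY : MemLp Y 2 μ) :
    (∫ y, Y y ∂μ) ^ 2 ≤ ∫ y, Y y ^ 2 ∂μ := by
  have := variance_nonneg Y μ
  rw [variance_eq_sub hY] at this
  simpa using this

end SampleMean

/-! ### The law of one observation -/

section Law

variable {d : ℕ} {p : Pt d → ℝ}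

/-- The law of one observation. -/
def law (p : Pt d → ℝ) : Measure (Pt d) :=
  volume.withDensity fun x => ENNReal.ofReal (p x)

theorem sampleLaw_eq (p : Pt d → ℝ) (n : ℕ) : sampleLaw p n = Measure.pi fun _ => law p := rfl

theorem IsDensity.isProbabilityMeasure (hp : IsDensity p) : IsProbabilityMeasure (law p) := by
  constructor
  rw [law, withDensity_apply _ MeasurableSet.univ, Measure.restrict_univ,
    ← ofReal_integral_eq_lintegral_ofReal hp.integrable (ae_of_all _ hp.nonneg),
    hp.integral_eq_one, ENNReal.ofReal_one]

theorem ae_le_of_eLpNorm_top_le {L : ℝ} (hL : 0 < L)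
    (hpL : eLpNorm p ∞ volume ≤ ENNReal.ofReal L) : ∀ᵐ x, p x ≤ L := by
  filter_upwards [ae_le_eLpNormEssSup (f := p) (μ := volume)] with x hx
  rw [eLpNorm_exponent_top] at hpL
  have h := hx.trans hpL
  rw [← ofReal_norm, ENNReal.ofReal_le_ofReal_iff hL.le] at h
  exact (le_abs_self _).trans h

/-- This domination lets L₂ functions with respect to Lebesgue measure, such as the rescaled
kernels, have finite second moments under the law. -/
theorem law_le {L : ℝ} (hL : ∀ᵐ x, p x ≤ L) :
    law p ≤ ENNReal.ofReal L • (volume : Measure (Pt d)) := by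
  rw [law, ← withDensity_const]
  refine withDensity_mono ?_
  filter_upwards [hL] with x hx
  exact ENNReal.ofReal_le_ofReal hx

theorem law_absolutelyContinuous (p : Pt d → ℝ) : law p ≪ (volume : Measure (Pt d)) :=
  withDensity_absolutelyContinuous _ _

theorem memLp_law {L : ℝ} (hL : ∀ᵐ x, p x ≤ L) {f : Pt d → ℝ} (hf : MemLp f 2 volume) :
    MemLp f 2 (law p) :=
  hf.of_measure_le_smul ENNReal.ofReal_ne_top (law_le hL)

theorem IsDensity.integral_law (hp : IsDensity p) (f : Pt d → ℝ) :
    ∫ x, f x ∂(law p) = ∫ x, f x * p x := by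
  have := integral_withDensity_eq_integral_toReal_smul₀ (μ := (volume : Measure (Pt d)))
    (f := fun x => ENNReal.ofReal (p x)) hp.integrable.aestronglyMeasurable.aemeasurable.ennreal_ofReal
    (ae_of_all _ fun _ => ENNReal.ofReal_lt_top) f
  rw [law, this]
  congr 1 with x
  rw [ENNReal.toReal_ofReal (hp.nonneg x), smul_eq_mul, mul_comm]

theorem IsDensity.memLp_two (hp : IsDensity p) {L : ℝ} (hL : ∀ᵐ x, p x ≤ L) :
    MemLp p 2 volume := by
  rw [memLp_two_iff_integrable_sq hp.integrable.aestronglyMeasurable]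
  refine (hp.integrable.const_mul L).mono' (hp.integrable.aestronglyMeasurable.pow 2) ?_
  filter_upwards [hL] with x hx
  rw [Real.norm_of_nonneg (sq_nonneg _), sq]
  exact mul_le_mul_of_nonneg_right hx (hp.nonneg x)

theorem IsDensity.integral_sq_law_le (hp : IsDensity p) {L : ℝ} (hL : ∀ᵐ x, p x ≤ L)
    {f : Pt d → ℝ} (hf : MemLp f 2 volume) :
    ∫ x, f x ^ 2 ∂(law p) ≤ L * ∫ x, f x ^ 2 := by
  rw [hp.integral_law, ← integral_const_mul]
  have hi := hf.integrable_sq.const_mul L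
  have hle : ∀ᵐ x, f x ^ 2 * p x ≤ L * f x ^ 2 := by
    filter_upwards [hL] with x hx
    rw [mul_comm]
    exact mul_le_mul_of_nonneg_right hx (sq_nonneg _)
  exact integral_mono_of_nonneg
    (ae_of_all _ fun x => mul_nonneg (sq_nonneg _) (hp.nonneg x)) hi hle

end Law

/-! ### The exact risk of the kernel estimator -/

section Risk

variable {d : ℕ} {p K : Pt d → ℝ}

theorem integral_scaled_kernel_sq {h : ℝ} (hh : 0 < h) :
    ∫ z : Pt d, ((h ^ d)⁻¹ * K (h⁻¹ • (-z))) ^ 2 = (h ^ d)⁻¹ * ∫ z, K z ^ 2 := by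
  have e1 : ∫ z : Pt d, ((h ^ d)⁻¹ * K (h⁻¹ • (-z))) ^ 2 =
      ∫ z : Pt d, ((h ^ d)⁻¹ * K (h⁻¹ • z)) ^ 2 :=
    integral_neg_eq_self (fun z : Pt d => ((h ^ d)⁻¹ * K (h⁻¹ • z)) ^ 2) volume
  have e2 := Measure.integral_comp_smul_of_nonneg (volume : Measure (Pt d))
      (fun z => ((h ^ d)⁻¹ * K z) ^ 2) h⁻¹ (hR := (inv_pos.2 hh).le)
  rw [e1, e2, finrank_euclideanSpace_fin, inv_pow, inv_inv, smul_eq_mul]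
  simp only [mul_pow]
  rw [integral_const_mul]
  have : h ^ d ≠ 0 := by positivity
  field_simp

/-- The integrated second moment of the rescaled kernel. -/
theorem IsDensity.integral_second_moment (hp : IsDensity p) (hK : MemLp K 2 volume) {h : ℝ}
    (hh : 0 < h) :
    Integrable (fun x => ∫ y, ((h ^ d)⁻¹ * K (h⁻¹ • (y - x))) ^ 2 * p y) volume ∧
    ∫ x, (∫ y, ((h ^ d)⁻¹ * K (h⁻¹ • (y - x))) ^ 2 * p y) = (h ^ d)⁻¹ * ∫ z, K z ^ 2 := by
  set k : Pt d → ℝ := fun z => ((h ^ d)⁻¹ * K (h⁻¹ • (-z))) ^ 2 with hk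
  have hki : Integrable k := by
    have h1 : MemLp (fun z => K (h⁻¹ • ((0 : Pt d) - z))) 2 volume :=
      memLp_scaled_sub hK (inv_ne_zero hh.ne') 0
    simp only [zero_sub] at h1
    exact (h1.const_mul _).integrable_sq
  -- In `x`, the second moment is the convolution of `p` with the reflected squared kernel, so its
  -- integral is the product of the two integrals.
  have hconv : (fun x => ∫ y, ((h ^ d)⁻¹ * K (h⁻¹ • (y - x))) ^ 2 * p y) =
      convolution p k (ContinuousLinearMap.mul ℝ ℝ) volume := by
    ext x
    rw [convolution_mul]
    simp only [hk, neg_sub, mul_comm]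
  rw [hconv]
  refine ⟨hp.integrable.integrable_convolution _ hki, ?_⟩
  rw [integral_convolution _ hp.integrable hki, hp.integral_eq_one, integral_scaled_kernel_sq hh]
  simp

/-- The squared `L₂` norm of the bias, in the Fourier domain. -/
def biasSq (Ψ p : Pt d → ℝ) (h : ℝ) : ℝ :=
  ∫ ξ, (1 - Ψ (h • ξ)) ^ 2 * ‖𝓕 (fun x => (p x : ℂ)) ξ‖ ^ 2

/-- The squared `L₂` norm of the mean of the estimator, in the Fourier domain. -/
def meanSq (Ψ p : Pt d → ℝ) (h : ℝ) : ℝ :=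
  ∫ ξ, Ψ (h • ξ) ^ 2 * ‖𝓕 (fun x => (p x : ℂ)) ξ‖ ^ 2

/-- The exact risk of the kernel estimator. -/
def kernelRisk (K Ψ p : Pt d → ℝ) (n : ℕ) (h : ℝ) : ℝ :=
  biasSq Ψ p h + (1 / (n : ℝ)) * ((h ^ d)⁻¹ * (∫ z, K z ^ 2) - meanSq Ψ p h)

theorem risk_kde_congr {K' : Pt d → ℝ} (hKK : K =ᵐ[volume] K') {h : ℝ} (hh : h ≠ 0) (n : ℕ) :
    risk (fun X : Fin n → Pt d => kde K h X) p = risk (fun X : Fin n → Pt d => kde K' h X) p := by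
  unfold risk
  congr 1 with X
  apply lintegral_congr_ae
  have : ∀ i, ∀ᵐ x, K (h⁻¹ • (X i - x)) = K' (h⁻¹ • (X i - x)) := fun i =>
    (quasiMeasurePreserving_scaled_sub (inv_ne_zero hh) (X i)).ae hKK
  filter_upwards [ae_all_iff.2 this] with x hx
  simp only [kde, hx]

theorem kde_eq (K : Pt d → ℝ) (h : ℝ) {n : ℕ} (X : Fin n → Pt d) (x : Pt d) :
    kde K h X x = (1 / (n : ℝ)) * ∑ i, ((h ^ d)⁻¹ * K (h⁻¹ • (X i - x))) := by
  rw [kde, ← Finset.mul_sum, ← mul_assoc]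
  congr 1
  rw [one_div, one_div, mul_inv]

theorem memLp_kde (hK : MemLp K 2 volume) {h : ℝ} (hh : h ≠ 0) {n : ℕ} (X : Fin n → Pt d) :
    MemLp (kde K h X) 2 volume := by
  refine MemLp.const_mul ?_ _
  exact memLp_finsetSum _ fun i _ => memLp_scaled_sub hK (inv_ne_zero hh) (X i)

/-- At fixed `x` the estimator is a sample mean, so its squared error splits into squared bias and
variance. Integrating in `x` gives the formula. Measurability of `K` provides the joint
measurability needed to exchange the integrals. -/
theorem risk_kde_of_measurable (hp : IsDensity p) {L : ℝ} (hL : ∀ᵐ x, p x ≤ L)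
    (hKm : Measurable K) (hK : MemLp K 2 volume) {Ψ : Pt d → ℝ}
    (hΨ : (fun ξ => (Ψ ξ : ℂ)) =ᵐ[volume]
      (𝓕 ((hK.ofReal (K := ℂ)).toLp _) : Lp ℂ 2 (volume : Measure (Pt d))))
    (hΨ01 : ∀ ξ, Ψ ξ ∈ Set.Icc (0 : ℝ) 1) {h : ℝ} (hh : 0 < h) {n : ℕ} (hn : 0 < n) :
    risk (fun X : Fin n → Pt d => kde K h X) p = ENNReal.ofReal (kernelRisk K Ψ p n h) := by
  have := hp.isProbabilityMeasure
  obtain ⟨hq, hq1, hq2⟩ :=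
    kernelMean_plancherel hK hΨ hΨ01 hp.integrable (hp.memLp_two hL) hh
  obtain ⟨hS, hS1⟩ := hp.integral_second_moment hK hh
  have hp2 := hp.memLp_two hL
  have hYm : ∀ x, MemLp (fun y => (h ^ d)⁻¹ * K (h⁻¹ • (y - x))) 2 (law p) := fun x =>
    memLp_law hL ((memLp_scaled_sub_right hK (inv_ne_zero hh.ne') x).const_mul _)
  have hpt : ∀ x, ∫⁻ X : Fin n → Pt d, ENNReal.ofReal ((kde K h X x - p x) ^ 2)
        ∂(sampleLaw p n) =
      ENNReal.ofReal ((kernelMean K h p x - p x) ^ 2 + (1 / (n : ℝ)) *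
        ((∫ y, ((h ^ d)⁻¹ * K (h⁻¹ • (y - x))) ^ 2 * p y) - kernelMean K h p x ^ 2)) := by
    intro x
    have := lintegral_sampleMean_sub_sq (hYm x) hn (p x)
    rw [hp.integral_law, hp.integral_law] at this
    simp only [kde_eq, sampleLaw_eq]
    exact this
  have hnn : ∀ x, 0 ≤ (kernelMean K h p x - p x) ^ 2 + (1 / (n : ℝ)) *
        ((∫ y, ((h ^ d)⁻¹ * K (h⁻¹ • (y - x))) ^ 2 * p y) - kernelMean K h p x ^ 2) := by
    intro x
    have h1 := sq_integral_le (hYm x)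
    rw [hp.integral_law, hp.integral_law] at h1
    exact add_nonneg (sq_nonneg _) (mul_nonneg (by positivity) (sub_nonneg.2 h1))
  have hi1 : Integrable (fun x => (kernelMean K h p x - p x) ^ 2) := (hq.sub hp2).integrable_sq
  have hi2 : Integrable (fun x => kernelMean K h p x ^ 2) := hq.integrable_sq
  have hi3 : Integrable (fun x => (1 / (n : ℝ)) *
        ((∫ y, ((h ^ d)⁻¹ * K (h⁻¹ • (y - x))) ^ 2 * p y) - kernelMean K h p x ^ 2)) :=
    (hS.sub hi2).const_mul _
  have hsf : SFinite (sampleLaw p n) := by rw [sampleLaw_eq]; infer_instance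
  unfold risk
  rw [lintegral_lintegral_swap]
  · simp only [hpt]
    have hi : Integrable (fun x => (kernelMean K h p x - p x) ^ 2 + (1 / (n : ℝ)) *
        ((∫ y, ((h ^ d)⁻¹ * K (h⁻¹ • (y - x))) ^ 2 * p y) - kernelMean K h p x ^ 2)) :=
      hi1.add hi3
    rw [← ofReal_integral_eq_lintegral_ofReal hi (ae_of_all _ hnn),
      integral_add hi1 hi3, integral_const_mul, integral_sub hS hi2, hS1, hq1, hq2]
    rfl
  · refine AEMeasurable.ennreal_ofReal (AEMeasurable.pow_const (AEMeasurable.sub ?_ ?_) 2)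
    · refine Measurable.aemeasurable ?_
      unfold kde
      refine measurable_const.mul (Finset.measurable_sum _ fun i _ => hKm.comp ?_)
      fun_prop
    · exact hp.integrable.aestronglyMeasurable.aemeasurable.comp_snd

/-- Neither side changes when `K` is replaced by a measurable version, even though the estimator
evaluates `K` pointwise: for each sample the estimates agree for almost every `x`. -/
theorem risk_kde (hp : IsDensity p) {L : ℝ} (hL : ∀ᵐ x, p x ≤ L)
    (hK : MemLp K 2 volume) {Ψ : Pt d → ℝ}
    (hΨ : (fun ξ => (Ψ ξ : ℂ)) =ᵐ[volume]
      (𝓕 ((hK.ofReal (K := ℂ)).toLp _) : Lp ℂ 2 (volume : Measure (Pt d))))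
    (hΨ01 : ∀ ξ, Ψ ξ ∈ Set.Icc (0 : ℝ) 1) {h : ℝ} (hh : 0 < h) {n : ℕ} (hn : 0 < n) :
    risk (fun X : Fin n → Pt d => kde K h X) p = ENNReal.ofReal (kernelRisk K Ψ p n h) := by
  have hae := hK.aestronglyMeasurable.ae_eq_mk
  set K' := hK.aestronglyMeasurable.mk K
  have hK' : MemLp K' 2 volume := (memLp_congr_ae hae).1 hK
  have e : (hK.ofReal (K := ℂ)).toLp _ = (hK'.ofReal (K := ℂ)).toLp _ := by
    rw [MemLp.toLp_eq_toLp_iff]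
    filter_upwards [hae] with x hx
    rw [hx]
  rw [e] at hΨ
  rw [risk_kde_congr hae hh.ne', risk_kde_of_measurable hp hL
    hK.aestronglyMeasurable.stronglyMeasurable_mk.measurable hK' hΨ hΨ01 hh hn]
  have : ∫ z, K z ^ 2 = ∫ z, K' z ^ 2 := by
    apply integral_congr_ae
    filter_upwards [hae] with x hx
    rw [hx]
  rw [kernelRisk, kernelRisk, this]

end Risk

/-! ### Monotonicity of bias and mean in the bandwidth -/

section Monotone

variable {d : ℕ} {K Ψ p : Pt d → ℝ}

theorem integrable_norm_fourier_sq (hp : Integrable p) (hp2 : MemLp p 2 volume) :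
    Integrable (fun ξ => ‖𝓕 (fun x => (p x : ℂ)) ξ‖ ^ 2) volume :=
  (memLp_fourier hp.ofReal hp2.ofReal).integrable_norm_pow (by norm_num)

theorem integral_norm_fourier_sq (hp : Integrable p) (hp2 : MemLp p 2 volume) :
    ∫ ξ, ‖𝓕 (fun x => (p x : ℂ)) ξ‖ ^ 2 = ∫ x, p x ^ 2 := by
  have h1 : Integrable (fun x => (p x : ℂ)) := hp.ofReal
  have h2 : MemLp (fun x => (p x : ℂ)) 2 volume := hp2.ofReal
  rw [integral_norm_sq_fourier_eq h1 h2]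
  simp

theorem integrable_weighted_fourier_sq (hp : Integrable p) (hp2 : MemLp p 2 volume)
    {w : Pt d → ℝ} (hw : AEStronglyMeasurable w volume) (hw01 : ∀ ξ, w ξ ∈ Set.Icc (0 : ℝ) 1) :
    Integrable (fun ξ => w ξ ^ 2 * ‖𝓕 (fun x => (p x : ℂ)) ξ‖ ^ 2) volume := by
  have h := integrable_norm_fourier_sq hp hp2
  refine h.mono' ((hw.pow 2).mul h.aestronglyMeasurable) (ae_of_all _ fun ξ => ?_)
  rw [Real.norm_of_nonneg (by positivity)]
  exact mul_le_of_le_one_left (sq_nonneg _) (pow_le_one₀ (hw01 ξ).1 (hw01 ξ).2)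

/-- The common source of the comparisons between bandwidths and, with the constant weight 1, of the
bounds by ∫ p². -/
theorem weighted_fourier_sq_mono (hp : Integrable p) (hp2 : MemLp p 2 volume)
    {w w' : Pt d → ℝ} (hw : AEStronglyMeasurable w volume) (hw01 : ∀ ξ, w ξ ∈ Set.Icc (0 : ℝ) 1)
    (hw' : ∀ ξ, 0 ≤ w' ξ) (hle : ∀ ξ, w' ξ ≤ w ξ) :
    ∫ ξ, w' ξ ^ 2 * ‖𝓕 (fun x => (p x : ℂ)) ξ‖ ^ 2 ≤
      ∫ ξ, w ξ ^ 2 * ‖𝓕 (fun x => (p x : ℂ)) ξ‖ ^ 2 := by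
  refine integral_mono_of_nonneg (ae_of_all _ fun ξ => by positivity)
    (integrable_weighted_fourier_sq hp hp2 hw hw01) (ae_of_all _ fun ξ => ?_)
  exact mul_le_mul_of_nonneg_right (pow_le_pow_left₀ (hw' ξ) (hle ξ) 2) (sq_nonneg _)

theorem aestronglyMeasurable_comp_smul (hΨ : MemLp Ψ 2 volume) {h : ℝ} (hh : 0 < h) :
    AEStronglyMeasurable (fun ξ => Ψ (h • ξ)) volume :=
  (memLp_comp_smul hΨ hh.ne').aestronglyMeasurable

theorem biasSq_nonneg (h : ℝ) : 0 ≤ biasSq Ψ p h := integral_nonneg fun _ => by positivity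

theorem meanSq_nonneg (h : ℝ) : 0 ≤ meanSq Ψ p h := integral_nonneg fun _ => by positivity

theorem biasSq_le_of_le (hp : Integrable p) (hp2 : MemLp p 2 volume) (hΨ : MemLp Ψ 2 volume)
    (hΨ01 : ∀ ξ, Ψ ξ ∈ Set.Icc (0 : ℝ) 1) {h h' : ℝ} (hh : 0 < h)
    (hmono : ∀ ξ, Ψ (h • ξ) ≤ Ψ (h' • ξ)) : biasSq Ψ p h' ≤ biasSq Ψ p h := by
  refine weighted_fourier_sq_mono (w := fun ξ => 1 - Ψ (h • ξ)) (w' := fun ξ => 1 - Ψ (h' • ξ))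
    hp hp2 (aestronglyMeasurable_const.sub (aestronglyMeasurable_comp_smul hΨ hh))
    (fun ξ => ⟨?_, ?_⟩) (fun ξ => ?_) (fun ξ => ?_)
  · linarith [(hΨ01 (h • ξ)).2]
  · linarith [(hΨ01 (h • ξ)).1]
  · linarith [(hΨ01 (h' • ξ)).2]
  · linarith [hmono ξ]

theorem meanSq_le_of_le (hp : Integrable p) (hp2 : MemLp p 2 volume) (hΨ : MemLp Ψ 2 volume)
    (hΨ01 : ∀ ξ, Ψ ξ ∈ Set.Icc (0 : ℝ) 1) {h h' : ℝ} (hh' : 0 < h')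
    (hmono : ∀ ξ, Ψ (h • ξ) ≤ Ψ (h' • ξ)) : meanSq Ψ p h ≤ meanSq Ψ p h' :=
  weighted_fourier_sq_mono (w := fun ξ => Ψ (h' • ξ)) (w' := fun ξ => Ψ (h • ξ))
    hp hp2 (aestronglyMeasurable_comp_smul hΨ hh') (fun _ => hΨ01 _) (fun _ => (hΨ01 _).1) hmono

theorem biasSq_le (hp : Integrable p) (hp2 : MemLp p 2 volume)
    (hΨ01 : ∀ ξ, Ψ ξ ∈ Set.Icc (0 : ℝ) 1) (h : ℝ) : biasSq Ψ p h ≤ ∫ x, p x ^ 2 := by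
  have := weighted_fourier_sq_mono (w := fun _ => 1) (w' := fun ξ => 1 - Ψ (h • ξ))
    hp hp2 aestronglyMeasurable_const (fun _ => by simp)
    (fun ξ => by linarith [(hΨ01 (h • ξ)).2]) (fun ξ => by linarith [(hΨ01 (h • ξ)).1])
  simpa [biasSq, integral_norm_fourier_sq hp hp2] using this

theorem meanSq_le (hp : Integrable p) (hp2 : MemLp p 2 volume)
    (hΨ01 : ∀ ξ, Ψ ξ ∈ Set.Icc (0 : ℝ) 1) (h : ℝ) : meanSq Ψ p h ≤ ∫ x, p x ^ 2 := by
  have := weighted_fourier_sq_mono (w := fun _ => 1) (w' := fun ξ => Ψ (h • ξ))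
    hp hp2 aestronglyMeasurable_const (fun _ => by simp)
    (fun _ => (hΨ01 _).1) (fun _ => (hΨ01 _).2)
  simpa [meanSq, integral_norm_fourier_sq hp hp2] using this

end Monotone

/-! ### Orthonormal bases of the span of the estimators -/

section Orthonormal

variable {d M r l : ℕ} {P : Fin M → Pt d → ℝ} {φ : Fin r → Pt d → ℝ}

theorem inner_toLp {f g : Pt d → ℝ} (hf : MemLp f 2 volume) (hg : MemLp g 2 volume) :
    inner ℝ (hf.toLp f) (hg.toLp g) = ∫ x, f x * g x := by
  rw [L2.inner_def]
  apply integral_congr_ae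
  filter_upwards [hf.coeFn_toLp, hg.coeFn_toLp] with x h1 h2
  rw [h1, h2]
  simp [mul_comm]

theorem IsOrthonormalBasisOfSpan.orthonormal_toLp (hφ : IsOrthonormalBasisOfSpan P φ) :
    Orthonormal ℝ fun k => (hφ.memLp k).toLp (φ k) := by
  classical
  rw [orthonormal_iff_ite]
  intro k k'
  rw [inner_toLp, hφ.orthonormal]

theorem toLp_sum {ι : Type*} (s : Finset ι) {f : ι → Pt d → ℝ} (hf : ∀ i, MemLp (f i) 2 volume)
    (c : ι → ℝ) (h : MemLp (fun x => ∑ i ∈ s, c i * f i x) 2 volume) :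
    h.toLp _ = ∑ i ∈ s, c i • (hf i).toLp (f i) := by
  apply Lp.ext
  have h1 : ∀ i ∈ s, (↑(c i • (hf i).toLp (f i)) : Pt d → ℝ) =ᵐ[volume] fun x => c i * f i x := by
    intro i _
    filter_upwards [Lp.coeFn_smul (c i) ((hf i).toLp (f i)), (hf i).coeFn_toLp] with x e1 e2
    rw [e1, Pi.smul_apply, e2, smul_eq_mul]
  have h3 : ∀ᵐ x, ∀ i ∈ s, (c i • (hf i).toLp (f i) : Lp ℝ 2 (volume : Measure (Pt d))) x =
      c i * f i x := by
    exact (Finset.eventually_all s).2 h1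
  filter_upwards [h.coeFn_toLp, Lp.coeFn_finsetSum s (fun i => c i • (hf i).toLp (f i)), h3]
    with x e1 e2 e3
  rw [e1, e2, Finset.sum_apply]
  exact Finset.sum_congr rfl fun i hi => (e3 i hi).symm

theorem memLp_lincomb {ι : Type*} (s : Finset ι) {f : ι → Pt d → ℝ}
    (hf : ∀ i, MemLp (f i) 2 volume) (c : ι → ℝ) :
    MemLp (fun x => ∑ i ∈ s, c i * f i x) 2 volume :=
  memLp_finsetSum _ fun i _ => (hf i).const_mul (c i)

/-- Bounds the number of coefficients to be estimated, hence the stochastic error. -/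
theorem IsOrthonormalBasisOfSpan.card_le (hφ : IsOrthonormalBasisOfSpan P φ)
    (hP : ∀ j, MemLp (P j) 2 volume) : r ≤ M := by
  have hli := hφ.orthonormal_toLp.linearIndependent
  set S := Submodule.span ℝ (Set.range fun j => (hP j).toLp (P j))
  have hmem : ∀ k, (hφ.memLp k).toLp (φ k) ∈ S := by
    intro k
    obtain ⟨c, hc⟩ := hφ.mem_span k
    have : (hφ.memLp k).toLp (φ k) = ∑ j, c j • (hP j).toLp (P j) := by
      rw [← toLp_sum Finset.univ hP c (memLp_lincomb _ hP c)]
      exact (MemLp.toLp_eq_toLp_iff _ _).2 hc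
    rw [this]
    exact Submodule.sum_mem _ fun j _ => Submodule.smul_mem _ _ (Submodule.subset_span ⟨j, rfl⟩)
  have hli' : LinearIndependent ℝ fun k => (⟨_, hmem k⟩ : S) :=
    LinearIndependent.of_comp S.subtype hli
  have : FiniteDimensional ℝ S := FiniteDimensional.span_of_finite ℝ (Set.finite_range _)
  have h1 := hli'.fintype_card_le_finrank
  have h2 := finrank_range_le_card (R := ℝ) (b := fun j => (hP j).toLp (P j))
  simp only [Fintype.card_fin] at h1 h2
  exact h1.trans h2

/-- A convex aggregate comes without a basis; one is supplied here for its analysis. -/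
theorem exists_isOrthonormalBasisOfSpan (hP : ∀ j, MemLp (P j) 2 volume) :
    ∃ (r : ℕ) (φ : Fin r → Pt d → ℝ), IsOrthonormalBasisOfSpan P φ := by
  set S := Submodule.span ℝ (Set.range fun j => (hP j).toLp (P j)) with hS
  have : FiniteDimensional ℝ S := FiniteDimensional.span_of_finite ℝ (Set.finite_range _)
  set b := stdOrthonormalBasis ℝ S
  have hmem : ∀ k, MemLp ((b k : Lp ℝ 2 (volume : Measure (Pt d))) : Pt d → ℝ) 2 volume :=
    fun k => Lp.memLp _
  refine ⟨Module.finrank ℝ S, fun k => (b k : Lp ℝ 2 (volume : Measure (Pt d))), hmem, ?_, ?_, ?_⟩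
  · intro k k'
    have h1 := orthonormal_iff_ite.1 b.orthonormal k k'
    rw [Submodule.coe_inner] at h1
    rw [← h1, ← inner_toLp (hmem k) (hmem k')]
    simp
  · intro k
    have h1 : (b k : Lp ℝ 2 (volume : Measure (Pt d))) ∈ S := (b k).2
    obtain ⟨c, hc⟩ := (Submodule.mem_span_range_iff_exists_fun ℝ).1 h1
    refine ⟨c, ?_⟩
    rw [← hc, ← toLp_sum Finset.univ hP c (memLp_lincomb _ hP c)]
    exact (memLp_lincomb _ hP c).coeFn_toLp
  · intro j
    have hj : (hP j).toLp (P j) ∈ S := Submodule.subset_span ⟨j, rfl⟩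
    refine ⟨fun k => b.repr ⟨_, hj⟩ k, ?_⟩
    have h1 := congrArg (Subtype.val) (b.sum_repr ⟨_, hj⟩)
    have h2 := toLp_sum Finset.univ hmem (fun k => b.repr ⟨_, hj⟩ k) (memLp_lincomb _ hmem _)
    have h3 : (hP j).toLp (P j) = (memLp_lincomb Finset.univ hmem
        (fun k => b.repr ⟨_, hj⟩ k)).toLp _ := by
      rw [h2]
      simp only [Lp.toLp_coeFn]
      simpa using h1.symm
    exact (MemLp.toLp_eq_toLp_iff _ _).1 h3

/-- Pythagoras: the error is the squared distance from `q` to the span plus the squared error of the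
coefficients. -/
theorem IsOrthonormalBasisOfSpan.integral_sub_sq (hφ : IsOrthonormalBasisOfSpan P φ)
    {f q : Pt d → ℝ} (hq : MemLp q 2 volume) {θ : Fin r → ℝ}
    (hf : f =ᵐ[volume] fun x => ∑ k, θ k * φ k x) :
    ∫ x, (f x - q x) ^ 2 = (∫ x, q x ^ 2) - ∑ k, (∫ x, φ k x * q x) ^ 2 +
      ∑ k, (θ k - ∫ x, φ k x * q x) ^ 2 := by
  have hs := memLp_lincomb Finset.univ hφ.memLp θ
  have h1 : ∫ x, (f x - q x) ^ 2 = ‖hs.toLp _ - hq.toLp q‖ ^ 2 := by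
    rw [← MemLp.toLp_sub, ← real_inner_self_eq_norm_sq, inner_toLp]
    apply integral_congr_ae
    filter_upwards [hf] with x hx
    rw [hx, sq]
    rfl
  have h2 : ‖hs.toLp _‖ ^ 2 = ∑ k, θ k ^ 2 := by
    rw [toLp_sum _ hφ.memLp, ← real_inner_self_eq_norm_sq, hφ.orthonormal_toLp.inner_sum]
    simp [sq]
  have h3 : ‖hq.toLp q‖ ^ 2 = ∫ x, q x ^ 2 := by
    rw [← real_inner_self_eq_norm_sq, inner_toLp]
    simp only [sq]
  rw [h1, norm_sub_sq_real, h2, h3, toLp_sum _ hφ.memLp, sum_inner]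
  simp only [real_inner_smul_left, inner_toLp, sub_sq, Finset.sum_add_distrib,
    Finset.sum_sub_distrib]
  rw [Finset.mul_sum]
  simp only [mul_assoc]
  ring

end Orthonormal

/-! ### Oracle inequality for aggregation of fixed functions -/

section Aggregation

variable {d M r l : ℕ} {P : Fin M → Pt d → ℝ} {φ : Fin r → Pt d → ℝ}

/-- The empirical mean of `f`. -/
def empMean (f : Pt d → ℝ) (Y : Fin l → Pt d) : ℝ := (1 / (l : ℝ)) * ∑ i, f (Y i)

/-- The squared error of the empirical coefficients. -/
def coeffError (p : Pt d → ℝ) (φ : Fin r → Pt d → ℝ) (Y : Fin l → Pt d) : ℝ :=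
  ∑ k, (empMean (φ k) Y - ∫ x, φ k x * p x) ^ 2

/-- Both errors contain the same squared distance from `p` to the span; what remains for the
aggregate is exactly the coefficient error. -/
theorem IsOrthonormalBasisOfSpan.linear_le (hφ : IsOrthonormalBasisOfSpan P φ)
    {p : Pt d → ℝ} (hp : MemLp p 2 volume) (Y : Fin l → Pt d) (j : Fin M) :
    ∫ x, ((∑ k, empMean (φ k) Y * φ k x) - p x) ^ 2 ≤
      (∫ x, (P j x - p x) ^ 2) + coeffError p φ Y := by
  obtain ⟨b, hb⟩ := hφ.span_le j
  rw [hφ.integral_sub_sq hp (ae_eq_refl fun x => ∑ k, empMean (φ k) Y * φ k x),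
    hφ.integral_sub_sq hp hb, coeffError]
  have : 0 ≤ ∑ k, (b k - ∫ x, φ k x * p x) ^ 2 := Finset.sum_nonneg fun _ _ => sq_nonneg _
  linarith

theorem simplex_segment {w w' : Fin M → ℝ} (hw : w ∈ simplex M) (hw' : w' ∈ simplex M) {t : ℝ}
    (ht0 : 0 ≤ t) (ht1 : t ≤ 1) : (fun j => w j + t * (w' j - w j)) ∈ simplex M := by
  refine ⟨fun j => ?_, ?_⟩
  · have := mul_nonneg ht0 (hw'.1 j)
    have := mul_nonneg (sub_nonneg.2 ht1) (hw.1 j)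
    linarith
  · rw [Finset.sum_add_distrib, ← Finset.mul_sum, Finset.sum_sub_distrib]
    nlinarith [hw.2, hw'.2]

/-- The first-order condition along a segment: for small `t` the linear term dominates. -/
theorem nonneg_of_forall_quadratic {a b : ℝ}
    (h : ∀ t : ℝ, 0 < t → t ≤ 1 → 0 ≤ t ^ 2 * a + 2 * t * b) : 0 ≤ b := by
  by_contra! hb
  have ha : 0 < a := by
    have := h 1 one_pos le_rfl
    linarith
  -- For this `t` one has t a + 2b ≤ b < 0, which contradicts the hypothesis.
  have ht : 0 < min 1 (-b / a) := lt_min one_pos (div_pos (by linarith) ha)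
  have h1 := h _ ht (min_le_left _ _)
  have h2 : min 1 (-b / a) * a ≤ -b := by
    rw [← le_div_iff₀ ha]; exact min_le_right _ _
  nlinarith

/-- In coordinates the criterion is |θ - e|² up to a constant, where e is the vector of empirical
coefficients, so a minimizer projects e onto a convex set. Let θ_w and θ_v be the coefficients of
the minimizer and of `P j`, θ* those of `p`, D = θ_v - θ_w and η = e - θ*. Then |θ_v - θ*|² + |η|² -
|θ_w - θ*|² = |D + η|² + 2⟨D, θ_w - e⟩, and the last product is nonnegative by optimality. -/
theorem IsOrthonormalBasisOfSpan.convex_le (hφ : IsOrthonormalBasisOfSpan P φ)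
    {p : Pt d → ℝ} (hp : MemLp p 2 volume)
    {β : Fin M → Fin r → ℝ} (hβ : ∀ j, P j =ᵐ[volume] fun x => ∑ k, β j k * φ k x)
    {Y : Fin l → Pt d} (hY : ∀ i j, P j (Y i) = ∑ k, β j k * φ k (Y i))
    {w : Fin M → ℝ} (hw : w ∈ simplex M) (hmin : IsMinOn (empCriterion P Y) (simplex M) w)
    (j : Fin M) :
    ∫ x, ((∑ j, w j * P j x) - p x) ^ 2 ≤ (∫ x, (P j x - p x) ^ 2) + coeffError p φ Y := by
  set θ : (Fin M → ℝ) → Fin r → ℝ := fun v k => ∑ j, v j * β j k with hθ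
  have hsum : ∀ v : Fin M → ℝ, (fun x => ∑ j, v j * P j x) =ᵐ[volume]
      fun x => ∑ k, θ v k * φ k x := by
    intro v
    filter_upwards [ae_all_iff.2 hβ] with x hx
    simp only [hx, hθ, Finset.mul_sum, Finset.sum_mul]
    rw [Finset.sum_comm]
    simp only [mul_assoc]
  have hcrit : ∀ v, empCriterion P Y v = ∑ k, (θ v k ^ 2 - 2 * θ v k * empMean (φ k) Y) := by
    intro v
    have e1 : ∫ x, (∑ j, v j * P j x) ^ 2 = ∑ k, θ v k ^ 2 := by
      have := hφ.integral_sub_sq (q := fun _ => 0) MemLp.zero' (hsum v)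
      simpa using this
    have e2 : ∀ i, ∑ j, v j * P j (Y i) = ∑ k, θ v k * φ k (Y i) := by
      intro i
      simp only [hY, hθ, Finset.mul_sum, Finset.sum_mul]
      rw [Finset.sum_comm]
      simp only [mul_assoc]
    rw [empCriterion, e1, Finset.sum_sub_distrib]
    congr 1
    simp only [e2, empMean]
    rw [Finset.sum_comm, Finset.mul_sum]
    refine Finset.sum_congr rfl fun k _ => ?_
    rw [← Finset.mul_sum]
    ring
  set v : Fin M → ℝ := Pi.single j 1 with hv
  have hvs : v ∈ simplex M := by
    refine ⟨fun i => ?_, ?_⟩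
    · rw [hv, Pi.single_apply]; split_ifs <;> norm_num
    · rw [hv, Finset.sum_pi_single']; simp
  have hθv : ∀ k, θ v k = β j k := by
    intro k
    simp [hθ, hv, Pi.single_apply]
  set D : Fin r → ℝ := fun k => θ v k - θ w k with hD
  have hopt : 0 ≤ ∑ k, D k * (θ w k - empMean (φ k) Y) := by
    refine nonneg_of_forall_quadratic (a := ∑ k, D k ^ 2) fun t ht0 ht1 => ?_
    have h1 := isMinOn_iff.1 hmin _ (simplex_segment hw hvs ht0.le ht1)
    have h2 : ∀ k, θ (fun i => w i + t * (v i - w i)) k = θ w k + t * D k := by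
      intro k
      simp only [hθ, hD, add_mul, mul_assoc, sub_mul, Finset.sum_add_distrib, ← Finset.mul_sum,
        Finset.sum_sub_distrib]
    rw [hcrit, hcrit, ← sub_nonneg, ← Finset.sum_sub_distrib] at h1
    simp only [h2] at h1
    rw [Finset.mul_sum, Finset.mul_sum, ← Finset.sum_add_distrib]
    refine h1.trans_eq (Finset.sum_congr rfl fun k _ => ?_)
    ring
  rw [hφ.integral_sub_sq hp (hsum w), hφ.integral_sub_sq hp (hβ j), coeffError]
  have key : 0 ≤ ∑ k, ((D k + (empMean (φ k) Y - ∫ x, φ k x * p x)) ^ 2 +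
      2 * (D k * (θ w k - empMean (φ k) Y))) := by
    rw [Finset.sum_add_distrib, ← Finset.mul_sum]
    have : 0 ≤ ∑ k, (D k + (empMean (φ k) Y - ∫ x, φ k x * p x)) ^ 2 :=
      Finset.sum_nonneg fun _ _ => sq_nonneg _
    linarith
  have hfin : ∑ k, (β j k - ∫ x, φ k x * p x) ^ 2 +
      ∑ k, (empMean (φ k) Y - ∫ x, φ k x * p x) ^ 2 - ∑ k, (θ w k - ∫ x, φ k x * p x) ^ 2 =
      ∑ k, ((D k + (empMean (φ k) Y - ∫ x, φ k x * p x)) ^ 2 +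
      2 * (D k * (θ w k - empMean (φ k) Y))) := by
    rw [← Finset.sum_add_distrib, ← Finset.sum_sub_distrib]
    refine Finset.sum_congr rfl fun k _ => ?_
    simp only [hD, hθv]
    ring
  linarith

/-- Each empirical coefficient has variance at most ∫ φ_k² p / l ≤ L / l, and there are at most `M`
of them. -/
theorem lintegral_coeffError_le {p : Pt d → ℝ} (hp : IsDensity p) {L : ℝ}
    (hL : ∀ᵐ x, p x ≤ L) (hL0 : 0 ≤ L) (hl : 0 < l) (hφ : IsOrthonormalBasisOfSpan P φ)
    (hP : ∀ j, MemLp (P j) 2 volume) :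
    ∫⁻ Y : Fin l → Pt d, ENNReal.ofReal (coeffError p φ Y) ∂(sampleLaw p l) ≤
      ENNReal.ofReal (L * M / l) := by
  have := hp.isProbabilityMeasure
  have hφl : ∀ k, MemLp (φ k) 2 (law p) := fun k => memLp_law hL (hφ.memLp k)
  have hm : ∀ k, AEMeasurable (fun Y : Fin l → Pt d =>
      ENNReal.ofReal ((empMean (φ k) Y - ∫ x, φ k x * p x) ^ 2)) (sampleLaw p l) := fun k =>
    (((memLp_sampleMean (hφl k) l).aestronglyMeasurable.aemeasurable.sub_const _).pow_const
      2).ennreal_ofReal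
  simp only [coeffError, ENNReal.ofReal_sum_of_nonneg fun _ _ => sq_nonneg _]
  rw [lintegral_finsetSum' _ fun k _ => hm k]
  have hk : ∀ k, ∫⁻ Y : Fin l → Pt d, ENNReal.ofReal ((empMean (φ k) Y - ∫ x, φ k x * p x) ^ 2)
      ∂(sampleLaw p l) ≤ ENNReal.ofReal (L / l) := by
    intro k
    have h1 := lintegral_sampleMean_sub_sq (hφl k) hl (∫ x, φ k x * p x)
    rw [hp.integral_law (φ k), sub_self] at h1
    refine (sampleLaw_eq p l ▸ h1).le.trans (ENNReal.ofReal_le_ofReal ?_)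
    have h2 := hp.integral_sq_law_le hL (hφ.memLp k)
    have h3 : ∫ x, φ k x ^ 2 = 1 := by
      have := hφ.orthonormal k k
      simpa [sq] using this
    rw [h3, mul_one] at h2
    have hl' : (0 : ℝ) < l := by positivity
    rw [one_div, div_eq_inv_mul]
    have h4 : (∫ y, φ k y ^ 2 ∂(law p)) - (∫ x, φ k x * p x) ^ 2 ≤ L := by
      linarith [sq_nonneg (∫ x, φ k x * p x)]
    have h5 := mul_le_mul_of_nonneg_left h4 (inv_pos.2 hl').le
    linarith
  refine (Finset.sum_le_sum fun k _ => hk k).trans ?_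
  rw [Finset.sum_const, Finset.card_univ, Fintype.card_fin, nsmul_eq_mul,
    ← ENNReal.ofReal_natCast, ← ENNReal.ofReal_mul (by positivity)]
  refine ENNReal.ofReal_le_ofReal ?_
  have hr : (r : ℝ) ≤ M := by exact_mod_cast hφ.card_le hP
  rw [mul_div_assoc', mul_comm]
  gcongr

theorem ae_sample_of_ae {p : Pt d → ℝ} (hp : IsDensity p) {Q : Pt d → Prop} (h : ∀ᵐ x, Q x)
    (i : Fin l) : ∀ᵐ Y ∂(sampleLaw p l), Q (Y i) := by
  have := hp.isProbabilityMeasure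
  exact (measurePreserving_eval (fun _ : Fin l => law p) i).quasiMeasurePreserving.ae
    ((law_absolutelyContinuous p).ae_le h)

theorem lintegral_sub_sq_eq {f q : Pt d → ℝ} (hf : MemLp f 2 volume) (hq : MemLp q 2 volume) :
    ∫⁻ x, ENNReal.ofReal ((f x - q x) ^ 2) = ENNReal.ofReal (∫ x, (f x - q x) ^ 2) :=
  (ofReal_integral_eq_lintegral_ofReal (hf.sub hq).integrable_sq
    (ae_of_all _ fun _ => sq_nonneg _)).symm

/-- The oracle inequality for aggregation of fixed functions. -/
theorem IsAggregate.lintegral_le {p : Pt d → ℝ} (hp : IsDensity p) {L : ℝ}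
    (hL : ∀ᵐ x, p x ≤ L) (hL0 : 0 ≤ L) (hl : 0 < l) (hP : ∀ j, MemLp (P j) 2 volume)
    {kind : Kind} {T : (Fin l → Pt d) → Pt d → ℝ} (hT : IsAggregate kind P T) (j : Fin M) :
    ∫⁻ Y, (∫⁻ x, ENNReal.ofReal ((T Y x - p x) ^ 2)) ∂(sampleLaw p l) ≤
      (∫⁻ x, ENNReal.ofReal ((P j x - p x) ^ 2)) + ENNReal.ofReal (L * M / l) := by
  have := hp.isProbabilityMeasure
  have hp2 := hp.memLp_two hL
  have hprob : IsProbabilityMeasure (sampleLaw p l) := by rw [sampleLaw_eq]; infer_instance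
  suffices H : ∃ (r : ℕ) (φ : Fin r → Pt d → ℝ), IsOrthonormalBasisOfSpan P φ ∧
      ∀ᵐ Y ∂(sampleLaw p l), ∫⁻ x, ENNReal.ofReal ((T Y x - p x) ^ 2) ≤
        ENNReal.ofReal ((∫ x, (P j x - p x) ^ 2) + coeffError p φ Y) by
    obtain ⟨r, φ, hφ, hle⟩ := H
    refine (lintegral_mono_ae hle).trans ?_
    have : ∀ Y : Fin l → Pt d, ENNReal.ofReal ((∫ x, (P j x - p x) ^ 2) + coeffError p φ Y) =
        ENNReal.ofReal (∫ x, (P j x - p x) ^ 2) + ENNReal.ofReal (coeffError p φ Y) := fun Y =>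
      ENNReal.ofReal_add (integral_nonneg fun _ => sq_nonneg _)
        (Finset.sum_nonneg fun _ _ => sq_nonneg _)
    simp only [this]
    rw [lintegral_add_left measurable_const, lintegral_const, measure_univ, mul_one,
      lintegral_sub_sq_eq (hP j) hp2]
    gcongr
    exact lintegral_coeffError_le hp hL hL0 hl hφ hP
  cases kind with
  | linear =>
    obtain ⟨r, φ, hφ, hTφ⟩ := hT
    refine ⟨r, φ, hφ, ae_of_all _ fun Y => ?_⟩
    have e : ∀ x, T Y x = ∑ k, empMean (φ k) Y * φ k x := fun x => hTφ Y x
    simp only [e]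
    rw [lintegral_sub_sq_eq (memLp_lincomb _ hφ.memLp _) hp2]
    exact ENNReal.ofReal_le_ofReal (hφ.linear_le hp2 Y j)
  | convex =>
    obtain ⟨w, hw, hTw⟩ := hT
    obtain ⟨r, φ, hφ⟩ := exists_isOrthonormalBasisOfSpan hP
    choose β hβ using hφ.span_le
    refine ⟨r, φ, hφ, ?_⟩
    -- The expansions in the auxiliary basis hold only almost everywhere, but the sample points
    -- almost surely avoid the exceptional null sets.
    have hae : ∀ᵐ Y ∂(sampleLaw p l), ∀ (i : Fin l) (j : Fin M),
        P j (Y i) = ∑ k, β j k * φ k (Y i) :=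
      ae_all_iff.2 fun i => ae_all_iff.2 fun j => ae_sample_of_ae hp (hβ j) i
    filter_upwards [hae] with Y hY
    simp only [hTw]
    rw [lintegral_sub_sq_eq (memLp_lincomb _ hP _) hp2]
    exact ENNReal.ofReal_le_ofReal (hφ.convex_le hp2 hβ hY (hw Y).1 (hw Y).2 j)

end Aggregation

/-! ### Sample splitting and averaging over splits -/

section Splits

variable {d n : ℕ} {p K : Pt d → ℝ}

theorem IsDensity.isProbabilityMeasure_sampleLaw (hp : IsDensity p) (n : ℕ) :
    IsProbabilityMeasure (sampleLaw p n) := by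
  have := hp.isProbabilityMeasure
  rw [sampleLaw_eq]
  infer_instance

theorem IsDensity.measurePreserving_split (hp : IsDensity p) (S : Split n) :
    MeasurePreserving (fun X : Fin n → Pt d => (S.train X, S.valid X)) (sampleLaw p n)
      ((sampleLaw p (trainSize n)).prod (sampleLaw p (validSize n))) := by
  have := hp.isProbabilityMeasure
  have h1 := (measurePreserving_piCongrLeft (fun _ : Fin n => law p) S).symm
  have h2 := measurePreserving_sumPiEquivProdPi
    (fun _ : Fin (trainSize n) ⊕ Fin (validSize n) => law p)
  exact h2.comp h1

theorem lintegral_prod_comp_measurePreserving {α β γ : Type*} [MeasurableSpace α]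
    [MeasurableSpace β] [MeasurableSpace γ] {μ : Measure α} {ν : Measure β} {ρ : Measure γ}
    [SFinite μ] [SFinite ν] [SFinite ρ] {f : α → β} (hf : MeasurePreserving f μ ν)
    {G : β × γ → ℝ≥0∞} (hG : AEMeasurable G (ν.prod ρ)) :
    AEMeasurable (fun q : α × γ => G (f q.1, q.2)) (μ.prod ρ) ∧
    ∫⁻ q : α × γ, G (f q.1, q.2) ∂(μ.prod ρ) = ∫⁻ y, ∫⁻ x, G (y, x) ∂ρ ∂ν := by
  have hmp := hf.prod (MeasurePreserving.id ρ)
  refine ⟨hG.comp_quasiMeasurePreserving hmp.quasiMeasurePreserving, ?_⟩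
  rw [← lintegral_prod _ hG, ← hmp.map_eq,
    lintegral_map' (hmp.map_eq.symm ▸ hG) hmp.measurable.aemeasurable]
  rfl

/-- For a frozen training sample the kernel estimators are fixed functions, so the inequality for
fixed functions applies and is then integrated over the training sample. -/
theorem lintegral_lintegral_aggregate_le (hp : IsDensity p) {L : ℝ} (hL : ∀ᵐ x, p x ≤ L)
    (hL0 : 0 ≤ L) (hK : MemLp K 2 volume) {m l M : ℕ} (hl : 0 < l) {b : Fin M → ℝ}
    (hb : ∀ j, 0 < b j) {kind : Kind} {T : (Fin m → Pt d) → (Fin l → Pt d) → Pt d → ℝ}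
    (hT : ∀ U, IsAggregate kind (fun j => kde K (b j) U) (T U)) (j : Fin M) :
    ∫⁻ U, ∫⁻ V, ∫⁻ x, ENNReal.ofReal ((T U V x - p x) ^ 2) ∂volume ∂(sampleLaw p l)
        ∂(sampleLaw p m) ≤
      risk (fun U : Fin m → Pt d => kde K (b j) U) p + ENNReal.ofReal (L * M / l) := by
  have := hp.isProbabilityMeasure_sampleLaw m
  calc _ ≤ ∫⁻ U : Fin m → Pt d,
        ((∫⁻ x, ENNReal.ofReal ((kde K (b j) U x - p x) ^ 2)) +
          ENNReal.ofReal (L * M / l)) ∂(sampleLaw p m) :=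
        lintegral_mono fun U => (hT U).lintegral_le hp hL hL0 hl
          (fun j => memLp_kde hK (hb j).ne' U) j
    _ = _ := by
        rw [lintegral_add_right _ measurable_const, lintegral_const, measure_univ, mul_one]
        rfl

theorem lintegral_comp_split_le (hp : IsDensity p) {L : ℝ} (hL : ∀ᵐ x, p x ≤ L) (hL0 : 0 ≤ L)
    (hK : MemLp K 2 volume) {m l M : ℕ} (hl : 0 < l) {b : Fin M → ℝ} (hb : ∀ j, 0 < b j)
    {kind : Kind} {f : (Fin n → Pt d) → (Fin m → Pt d) × (Fin l → Pt d)}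
    (hf : MeasurePreserving f (sampleLaw p n) ((sampleLaw p m).prod (sampleLaw p l)))
    {T : (Fin m → Pt d) → (Fin l → Pt d) → Pt d → ℝ}
    (hT : ∀ U, IsAggregate kind (fun j => kde K (b j) U) (T U))
    (hTm : AEMeasurable (fun q : ((Fin m → Pt d) × (Fin l → Pt d)) × Pt d => T q.1.1 q.1.2 q.2)
      (((sampleLaw p m).prod (sampleLaw p l)).prod volume)) (j : Fin M) :
    AEMeasurable (fun q : (Fin n → Pt d) × Pt d =>
      ENNReal.ofReal ((T (f q.1).1 (f q.1).2 q.2 - p q.2) ^ 2)) ((sampleLaw p n).prod volume) ∧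
    ∫⁻ q : (Fin n → Pt d) × Pt d,
      ENNReal.ofReal ((T (f q.1).1 (f q.1).2 q.2 - p q.2) ^ 2) ∂((sampleLaw p n).prod volume) ≤
      risk (fun U : Fin m → Pt d => kde K (b j) U) p + ENNReal.ofReal (L * M / l) := by
  have := hp.isProbabilityMeasure_sampleLaw n
  have := hp.isProbabilityMeasure_sampleLaw m
  have := hp.isProbabilityMeasure_sampleLaw l
  have hGm : AEMeasurable (fun q : ((Fin m → Pt d) × (Fin l → Pt d)) × Pt d =>
      ENNReal.ofReal ((T q.1.1 q.1.2 q.2 - p q.2) ^ 2))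
      (((sampleLaw p m).prod (sampleLaw p l)).prod volume) :=
    ((hTm.sub hp.integrable.aestronglyMeasurable.aemeasurable.comp_snd).pow_const
      2).ennreal_ofReal
  obtain ⟨h1, h2⟩ := lintegral_prod_comp_measurePreserving hf hGm
  refine ⟨h1, h2.le.trans ?_⟩
  rw [lintegral_prod _ hGm.lintegral_prod_right']
  exact lintegral_lintegral_aggregate_le hp hL hL0 hK hl hb hT j

theorem lintegral_split_le (hp : IsDensity p) {L : ℝ} (hL : ∀ᵐ x, p x ≤ L) (hL0 : 0 ≤ L)
    (hK : MemLp K 2 volume) {a₀ : ℝ} (hb : ∀ j, 0 < bandwidth d a₀ n j) (hl : 0 < validSize n)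
    {kind : Kind} (S : Split n)
    {T : (Fin (trainSize n) → Pt d) → (Fin (validSize n) → Pt d) → Pt d → ℝ}
    (hT : IsSplitAggregate kind K p a₀ n T) (j : Fin (gridSize d a₀ n)) :
    AEMeasurable (fun q : (Fin n → Pt d) × Pt d =>
      ENNReal.ofReal ((T (S.train q.1) (S.valid q.1) q.2 - p q.2) ^ 2))
      ((sampleLaw p n).prod volume) ∧
    ∫⁻ q : (Fin n → Pt d) × Pt d,
      ENNReal.ofReal ((T (S.train q.1) (S.valid q.1) q.2 - p q.2) ^ 2)
        ∂((sampleLaw p n).prod volume) ≤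
      risk (fun U : Fin (trainSize n) → Pt d => kde K (bandwidth d a₀ n j) U) p +
        ENNReal.ofReal (L * gridSize d a₀ n / validSize n) :=
  lintegral_comp_split_le hp hL hL0 hK hl hb (hp.measurePreserving_split S) hT.isAggregate
    hT.aemeasurable j

/-- The oracle inequality for the averaged kernel aggregate. -/
theorem risk_averaged_le (hp : IsDensity p) {L : ℝ} (hL : ∀ᵐ x, p x ≤ L) (hL0 : 0 ≤ L)
    (hK : MemLp K 2 volume) {a₀ : ℝ} (hb : ∀ j, 0 < bandwidth d a₀ n j) (hl : 0 < validSize n)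
    {kind : Kind} {𝒮 : Finset (Split n)} (h𝒮 : 𝒮.Nonempty)
    {T : Split n → (Fin (trainSize n) → Pt d) → (Fin (validSize n) → Pt d) → Pt d → ℝ}
    (hT : ∀ S ∈ 𝒮, IsSplitAggregate kind K p a₀ n (T S)) (j : Fin (gridSize d a₀ n)) :
    risk (averaged 𝒮 T) p ≤
      risk (fun U : Fin (trainSize n) → Pt d => kde K (bandwidth d a₀ n j) U) p +
        ENNReal.ofReal (L * gridSize d a₀ n / validSize n) := by
  have := hp.isProbabilityMeasure_sampleLaw n
  have hc : (0 : ℝ) < 𝒮.card := by exact_mod_cast h𝒮.card_pos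
  -- By Cauchy-Schwarz the loss of the average is at most the average of the losses, so the number
  -- of splits and their dependence play no role.
  have hpt : ∀ (X : Fin n → Pt d) x, ENNReal.ofReal ((averaged 𝒮 T X x - p x) ^ 2) ≤
      ∑ S ∈ 𝒮, ENNReal.ofReal (1 / (𝒮.card : ℝ)) *
        ENNReal.ofReal ((T S (S.train X) (S.valid X) x - p x) ^ 2) := by
    intro X x
    simp only [← ENNReal.ofReal_mul (one_div_nonneg.2 hc.le)]
    rw [← ENNReal.ofReal_sum_of_nonneg fun S _ => by positivity]
    refine ENNReal.ofReal_le_ofReal ?_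
    rw [← Finset.mul_sum]
    have h1 := sq_sum_le_card_mul_sum_sq (s := 𝒮)
      (f := fun S => T S (S.train X) (S.valid X) x - p x)
    have h2 : averaged 𝒮 T X x - p x =
        (1 / (𝒮.card : ℝ)) * ∑ S ∈ 𝒮, (T S (S.train X) (S.valid X) x - p x) := by
      rw [averaged, Finset.sum_sub_distrib, Finset.sum_const, nsmul_eq_mul]
      field_simp
    rw [h2, mul_pow]
    calc _ ≤ (1 / (𝒮.card : ℝ)) ^ 2 *
          (𝒮.card * ∑ S ∈ 𝒮, (T S (S.train X) (S.valid X) x - p x) ^ 2) := by gcongr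
      _ = _ := by field_simp
  have hS := fun S (hS : S ∈ 𝒮) => lintegral_split_le hp hL hL0 hK hb hl S (hT S hS) j
  have hmeas : ∀ S ∈ 𝒮, AEMeasurable (fun q : (Fin n → Pt d) × Pt d =>
      ENNReal.ofReal (1 / (𝒮.card : ℝ)) *
        ENNReal.ofReal ((T S (S.train q.1) (S.valid q.1) q.2 - p q.2) ^ 2))
      ((sampleLaw p n).prod volume) := fun S h => (hS S h).1.const_mul _
  set R := risk (fun U : Fin (trainSize n) → Pt d => kde K (bandwidth d a₀ n j) U) p +
        ENNReal.ofReal (L * gridSize d a₀ n / validSize n)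
  calc risk (averaged 𝒮 T) p
      ≤ ∫⁻ X, ∫⁻ x, ∑ S ∈ 𝒮, ENNReal.ofReal (1 / (𝒮.card : ℝ)) *
        ENNReal.ofReal ((T S (S.train X) (S.valid X) x - p x) ^ 2) ∂volume ∂(sampleLaw p n) :=
        lintegral_mono fun X => lintegral_mono fun x => hpt X x
    _ = ∫⁻ q : (Fin n → Pt d) × Pt d, ∑ S ∈ 𝒮, ENNReal.ofReal (1 / (𝒮.card : ℝ)) *
        ENNReal.ofReal ((T S (S.train q.1) (S.valid q.1) q.2 - p q.2) ^ 2)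
          ∂((sampleLaw p n).prod volume) :=
        (lintegral_prod _ (Finset.aemeasurable_fun_sum 𝒮 hmeas)).symm
    _ = ∑ S ∈ 𝒮, ENNReal.ofReal (1 / (𝒮.card : ℝ)) * ∫⁻ q : (Fin n → Pt d) × Pt d,
        ENNReal.ofReal ((T S (S.train q.1) (S.valid q.1) q.2 - p q.2) ^ 2)
          ∂((sampleLaw p n).prod volume) := by
        rw [lintegral_finsetSum' _ hmeas]
        exact Finset.sum_congr rfl fun S h => lintegral_const_mul'' _ (hS S h).1
    _ ≤ ∑ S ∈ 𝒮, ENNReal.ofReal (1 / (𝒮.card : ℝ)) * R :=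
        Finset.sum_le_sum fun S h => mul_le_mul_right (hS S h).2 _
    _ = R := by
        rw [Finset.sum_const, nsmul_eq_mul, ← mul_assoc, ← ENNReal.ofReal_natCast,
          ← ENNReal.ofReal_mul hc.le, mul_one_div_cancel hc.ne', ENNReal.ofReal_one, one_mul]

end Splits

/-! ### Comparing risks across bandwidths and sample sizes -/

section Kernel

variable {d : ℕ} {p K Φ : Pt d → ℝ}

/-- The version `Φ` of the Fourier transform, in Mathlib's normalization. -/
def rescaledVersion (Φ : Pt d → ℝ) (ξ : Pt d) : ℝ := Φ ((-(2 * Real.pi)) • ξ)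

theorem rescaledVersion_ae_eq (hK : MemLp K 2 volume) (hΦ : IsFourierVersion K hK Φ) :
    (fun ξ => (rescaledVersion Φ ξ : ℂ)) =ᵐ[volume]
      (𝓕 ((hK.ofReal (K := ℂ)).toLp _) : Lp ℂ 2 (volume : Measure (Pt d))) := by
  have hπ : (-(2 * Real.pi)) ≠ 0 := by simp [Real.pi_ne_zero]
  have hq : Measure.QuasiMeasurePreserving (fun ξ : Pt d => (-(2 * Real.pi)) • ξ)
      volume volume := by
    refine ⟨measurable_const_smul _, ?_⟩
    rw [Measure.map_addHaar_smul volume hπ]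
    exact Measure.smul_absolutelyContinuous
  have h := hq.ae hΦ
  filter_upwards [h] with ξ hξ
  rw [rescaledVersion, hξ, smul_smul, neg_mul_neg, inv_mul_cancel₀ (by positivity), one_smul]

/-- The risk of the kernel estimator with bandwidth `h` and sample size `n`. -/
def kdeRisk (K p : Pt d → ℝ) (n : ℕ) (h : ℝ) : ℝ≥0∞ :=
  risk (fun X : Fin n → Pt d => kde K h X) p

/-- The standing assumptions on the density and the kernel. -/
structure Assumptions (p K Φ : Pt d → ℝ) (L : ℝ) : Prop where
  density : IsDensity p
  le_bound : ∀ᵐ x, p x ≤ L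
  memLp : MemLp K 2 volume
  version : IsFourierVersion K memLp Φ
  mem_Icc : ∀ t, Φ t ∈ Set.Icc (0 : ℝ) 1
  mono : ∀ (t : Pt d) (h h' : ℝ), 0 < h' → h' < h → Φ (h • t) ≤ Φ (h' • t)

namespace Assumptions

variable {L : ℝ}

theorem kdeRisk_eq (H : Assumptions p K Φ L) {n : ℕ} (hn : 0 < n) {h : ℝ} (hh : 0 < h) :
    kdeRisk K p n h = ENNReal.ofReal (kernelRisk K (rescaledVersion Φ) p n h) :=
  risk_kde H.density H.le_bound H.memLp (rescaledVersion_ae_eq H.memLp H.version)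
    (fun _ => H.mem_Icc _) hh hn

theorem rescaledVersion_mono (H : Assumptions p K Φ L) {h h' : ℝ} (hh' : 0 < h') (hle : h' ≤ h)
    (ξ : Pt d) : rescaledVersion Φ (h • ξ) ≤ rescaledVersion Φ (h' • ξ) := by
  rcases hle.eq_or_lt with rfl | hlt
  · exact le_rfl
  · unfold rescaledVersion
    rw [smul_comm _ h, smul_comm _ h']
    exact H.mono _ h h' hh' hlt

theorem biasSq_mono (H : Assumptions p K Φ L) {h h' : ℝ} (hh' : 0 < h') (hle : h' ≤ h) :
    biasSq (rescaledVersion Φ) p h' ≤ biasSq (rescaledVersion Φ) p h :=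
  biasSq_le_of_le H.density.integrable (H.density.memLp_two H.le_bound)
    (memLp_of_fourier_version H.memLp (rescaledVersion_ae_eq H.memLp H.version))
    (fun _ => H.mem_Icc _) (hh'.trans_le hle) (H.rescaledVersion_mono hh' hle)

theorem meanSq_anti (H : Assumptions p K Φ L) {h h' : ℝ} (hh' : 0 < h') (hle : h' ≤ h) :
    meanSq (rescaledVersion Φ) p h ≤ meanSq (rescaledVersion Φ) p h' :=
  meanSq_le_of_le H.density.integrable (H.density.memLp_two H.le_bound)
    (memLp_of_fourier_version H.memLp (rescaledVersion_ae_eq H.memLp H.version))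
    (fun _ => H.mem_Icc _) hh' (H.rescaledVersion_mono hh' hle)

theorem biasSq_le_integral_sq (H : Assumptions p K Φ L) (h : ℝ) :
    biasSq (rescaledVersion Φ) p h ≤ ∫ x, p x ^ 2 :=
  biasSq_le H.density.integrable (H.density.memLp_two H.le_bound) (fun _ => H.mem_Icc _) h

theorem meanSq_le_integral_sq (H : Assumptions p K Φ L) (h : ℝ) :
    meanSq (rescaledVersion Φ) p h ≤ ∫ x, p x ^ 2 :=
  meanSq_le H.density.integrable (H.density.memLp_two H.le_bound) (fun _ => H.mem_Icc _) h

/-- Decreasing the bandwidth by a factor `b` inflates the risk by at most `b ^ d`, up to a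
parametric term. -/
theorem kdeRisk_le_of_le (H : Assumptions p K Φ L) {n : ℕ} (hn : 0 < n) {h h' b : ℝ}
    (hh' : 0 < h') (hle : h' ≤ h) (hb : 1 ≤ b) (hbh : h ≤ b * h') :
    kdeRisk K p n h' ≤ ENNReal.ofReal (b ^ d) * kdeRisk K p n h +
      ENNReal.ofReal (b ^ d * (∫ x, p x ^ 2) / n) := by
  have hh : 0 < h := hh'.trans_le hle
  have hn' : (0 : ℝ) < n := by exact_mod_cast hn
  have hbd : 1 ≤ b ^ d := one_le_pow₀ hb
  have hb0 : 0 < b := by linarith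
  rw [H.kdeRisk_eq hn hh', H.kdeRisk_eq hn hh, ← ENNReal.ofReal_mul (by positivity)]
  refine le_trans (ENNReal.ofReal_le_ofReal ?_) ENNReal.ofReal_add_le
  have h1 := H.biasSq_mono hh' hle
  have h2 := H.meanSq_anti hh' hle
  have h3 := H.meanSq_le_integral_sq h
  have h4 : 0 ≤ biasSq (rescaledVersion Φ) p h := biasSq_nonneg h
  have h5 : 0 ≤ meanSq (rescaledVersion Φ) p h := meanSq_nonneg h
  have hκ : 0 ≤ ∫ z, K z ^ 2 := integral_nonneg fun _ => sq_nonneg _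
  have h6 : (h' ^ d)⁻¹ ≤ b ^ d * (h ^ d)⁻¹ := by
    rw [← div_eq_mul_inv, le_div_iff₀ (by positivity), inv_mul_le_iff₀ (by positivity), mul_comm,
      ← mul_pow]
    exact pow_le_pow_left₀ hh.le hbh d
  have h7 := mul_le_mul_of_nonneg_right h6 hκ
  have h8 : biasSq (rescaledVersion Φ) p h ≤ b ^ d * biasSq (rescaledVersion Φ) p h :=
    le_mul_of_one_le_left h4 hbd
  -- The variance contains `-meanSq`, which multiplication by `b ^ d` makes more negative. The
  -- excess to be compensated is (b^d - 1) times `meanSq`, which is the origin of the parametric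
  -- term.
  have h9 : (b ^ d - 1) * meanSq (rescaledVersion Φ) p h ≤ b ^ d * ∫ x, p x ^ 2 := by
    have := mul_le_mul_of_nonneg_left h3 (by linarith : 0 ≤ b ^ d)
    linarith
  unfold kernelRisk
  calc _ ≤ b ^ d * biasSq (rescaledVersion Φ) p h + (1 / (n : ℝ)) *
        (b ^ d * ((h ^ d)⁻¹ * (∫ z, K z ^ 2) - meanSq (rescaledVersion Φ) p h) +
          b ^ d * ∫ x, p x ^ 2) := by
        refine add_le_add (h1.trans h8) (mul_le_mul_of_nonneg_left ?_ (by positivity))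
        linarith
    _ = _ := by ring

theorem kdeRisk_one_le_of_one_le (H : Assumptions p K Φ L) {n : ℕ} (hn : 0 < n) {h : ℝ}
    (hh : 1 ≤ h) :
    kdeRisk K p n 1 ≤ kdeRisk K p n h + ENNReal.ofReal ((∫ z, K z ^ 2) / n) := by
  have hn' : (0 : ℝ) < n := by exact_mod_cast hn
  have hh0 : 0 < h := by linarith
  rw [H.kdeRisk_eq hn one_pos, H.kdeRisk_eq hn hh0]
  refine le_trans (ENNReal.ofReal_le_ofReal ?_) ENNReal.ofReal_add_le
  have h1 := H.biasSq_mono one_pos hh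
  have h2 := H.meanSq_anti one_pos hh
  have hκ : 0 ≤ ∫ z, K z ^ 2 := integral_nonneg fun _ => sq_nonneg _
  have hk2 : 0 ≤ (h ^ d)⁻¹ * ∫ z, K z ^ 2 := by positivity
  unfold kernelRisk
  calc _ ≤ biasSq (rescaledVersion Φ) p h + (1 / (n : ℝ)) *
        (((h ^ d)⁻¹ * (∫ z, K z ^ 2) - meanSq (rescaledVersion Φ) p h) + ∫ z, K z ^ 2) := by
        refine add_le_add h1 (mul_le_mul_of_nonneg_left ?_ (by positivity))
        rw [one_pow, inv_one, one_mul]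
        linarith
    _ = _ := by ring

theorem kdeRisk_sampleSize (H : Assumptions p K Φ L) {m n : ℕ} (hm : 0 < m) (hmn : m ≤ n) {h : ℝ}
    (hh : 0 < h) :
    kdeRisk K p m h ≤ ENNReal.ofReal ((n : ℝ) / m) * kdeRisk K p n h := by
  have hm' : (0 : ℝ) < m := by exact_mod_cast hm
  have hn' : (0 : ℝ) < n := hm'.trans_le (by exact_mod_cast hmn)
  rw [H.kdeRisk_eq hm hh, H.kdeRisk_eq (hm.trans_le hmn) hh, ← ENNReal.ofReal_mul (by positivity)]
  refine ENNReal.ofReal_le_ofReal ?_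
  have h4 : 0 ≤ biasSq (rescaledVersion Φ) p h := biasSq_nonneg h
  have h1 : 1 ≤ (n : ℝ) / m := by
    rw [one_le_div hm']; exact_mod_cast hmn
  unfold kernelRisk
  have h2 := le_mul_of_one_le_left h4 h1
  have h3 : ∀ V : ℝ, (n : ℝ) / m * (1 / n * V) = 1 / m * V := fun V => by field_simp
  rw [mul_add, h3]
  linarith

theorem kdeRisk_one_le_of_small (H : Assumptions p K Φ L) {n : ℕ} (hn : 0 < n) {h Λ : ℝ}
    (hh : 0 < h) (hΛ : n * Λ ≤ (h ^ d)⁻¹)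
    (hlarge : 2 * (∫ x, p x ^ 2) + (∫ z, K z ^ 2) ≤ (∫ z, K z ^ 2) * Λ) :
    kdeRisk K p n 1 ≤ kdeRisk K p n h := by
  have hn' : (1 : ℝ) ≤ n := by exact_mod_cast hn
  rw [H.kdeRisk_eq hn one_pos, H.kdeRisk_eq hn hh]
  refine ENNReal.ofReal_le_ofReal ?_
  have hκ : 0 ≤ ∫ z, K z ^ 2 := integral_nonneg fun _ => sq_nonneg _
  have hQ : 0 ≤ ∫ z, p z ^ 2 := integral_nonneg fun _ => sq_nonneg _
  have h1 := H.biasSq_le_integral_sq 1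
  have h2 : 0 ≤ meanSq (rescaledVersion Φ) p 1 := meanSq_nonneg 1
  have h3 : 0 ≤ biasSq (rescaledVersion Φ) p h := biasSq_nonneg h
  have h4 := H.meanSq_le_integral_sq h
  have h5 := mul_le_mul_of_nonneg_right hΛ hκ
  unfold kernelRisk
  have h6 : (1 / (n : ℝ)) * ((1 ^ d)⁻¹ * (∫ z, K z ^ 2) - meanSq (rescaledVersion Φ) p 1) ≤
      ∫ z, K z ^ 2 := by
    rw [one_pow, inv_one, one_mul, one_div, inv_mul_le_iff₀ (by linarith)]
    have := le_mul_of_one_le_left hκ hn'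
    linarith
  have h7 : (∫ z, K z ^ 2) * Λ - ∫ x, p x ^ 2 ≤
      (1 / (n : ℝ)) * ((h ^ d)⁻¹ * (∫ z, K z ^ 2) - meanSq (rescaledVersion Φ) p h) := by
    rw [one_div, le_inv_mul_iff₀ (by linarith)]
    have := le_mul_of_one_le_left hQ hn'
    nlinarith
  linarith

end Assumptions

theorem kdeRisk_eq_of_integral_sq_eq_zero (hK : MemLp K 2 volume) (h0 : ∫ z, K z ^ 2 = 0)
    (n : ℕ) {h h' : ℝ} (hh : 0 < h) (hh' : 0 < h') : kdeRisk K p n h = kdeRisk K p n h' := by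
  have hae : K =ᵐ[volume] fun _ => (0 : ℝ) := by
    have := (integral_eq_zero_iff_of_nonneg (fun z => sq_nonneg (K z)) hK.integrable_sq).1 h0
    filter_upwards [this] with x hx
    simpa using hx
  unfold kdeRisk
  rw [risk_kde_congr hae hh.ne', risk_kde_congr hae hh'.ne']
  congr 1
  ext X x
  simp [kde]

end Kernel

section Grid

variable {d n : ℕ} {a₀ : ℝ}

theorem one_le_log (hn : 3 ≤ n) : 1 ≤ Real.log n := by
  have h3 : (3 : ℝ) ≤ n := by exact_mod_cast hn
  rw [Real.le_log_iff_exp_le (by linarith)]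
  have := Real.exp_one_lt_d9
  linarith

theorem one_le_mul_log (hn : 3 ≤ n) : 1 ≤ (n : ℝ) * Real.log n := by
  have h3 : (3 : ℝ) ≤ n := by exact_mod_cast hn
  nlinarith [one_le_log hn]

theorem minBandwidth_pos (hn : 3 ≤ n) : 0 < minBandwidth d n :=
  Real.rpow_pos_of_pos (by linarith [one_le_mul_log hn]) _

theorem inv_minBandwidth_pow (hd : 0 < d) (hn : 3 ≤ n) :
    (minBandwidth d n ^ d)⁻¹ = n * Real.log n := by
  have h1 := one_le_mul_log hn
  have hd' : (d : ℝ) ≠ 0 := by positivity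
  rw [minBandwidth, ← Real.rpow_natCast, ← Real.rpow_mul (by linarith), neg_mul,
    one_div_mul_cancel hd', Real.rpow_neg_one, inv_inv]

theorem inv_minBandwidth_le (hd : 0 < d) (hn : 3 ≤ n) :
    (minBandwidth d n)⁻¹ ≤ (n : ℝ) ^ 2 := by
  have h1 := one_le_mul_log hn
  have hd' : (1 : ℝ) ≤ d := by exact_mod_cast hd
  rw [minBandwidth, Real.rpow_neg (by linarith), inv_inv]
  have h2 : ((n : ℝ) * Real.log n) ^ (1 / (d : ℝ)) ≤ ((n : ℝ) * Real.log n) ^ (1 : ℝ) :=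
    Real.rpow_le_rpow_of_exponent_le h1 (by rw [div_le_one (by linarith)]; exact hd')
  rw [Real.rpow_one] at h2
  refine h2.trans ?_
  rw [sq]
  exact mul_le_mul_of_nonneg_left (Real.log_le_self (by positivity)) (by positivity)

theorem gridStep_pos (ha₀ : 0 < a₀) (hn : 3 ≤ n) : 0 < gridStep a₀ n :=
  div_pos ha₀ (by linarith [one_le_log hn])

theorem gridStep_le (ha₀ : 0 < a₀) (hn : 3 ≤ n) : gridStep a₀ n ≤ a₀ :=
  div_le_self ha₀.le (one_le_log hn)

theorem bandwidth_pos (ha₀ : 0 < a₀) (hn : 3 ≤ n) (j : Fin (gridSize d a₀ n)) :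
    0 < bandwidth d a₀ n j := by
  unfold bandwidth
  have h1 := gridStep_pos ha₀ hn
  have h2 := minBandwidth_pos (d := d) hn
  split_ifs <;> positivity

theorem exponent_le (hd : 0 < d) (ha₀ : 0 < a₀) (hn : 3 ≤ n) {j : ℕ}
    (hj : minBandwidth d n * (1 + gridStep a₀ n) ^ j < 1) :
    (j : ℝ) ≤ 2 * (1 + a₀) / a₀ * Real.log n ^ 2 := by
  have h0 := minBandwidth_pos (d := d) hn
  have ha := gridStep_pos ha₀ hn
  have hlg := one_le_log hn
  have h1 : (1 + gridStep a₀ n) ^ j ≤ (n : ℝ) ^ 2 := by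
    refine le_trans ?_ (inv_minBandwidth_le hd hn)
    rw [← one_div, le_div_iff₀' h0]
    exact hj.le
  have h2 := Real.log_le_log (by positivity) h1
  rw [Real.log_pow, Real.log_pow] at h2
  have h3 := Real.one_sub_inv_le_log_of_pos (by linarith : 0 < 1 + gridStep a₀ n)
  have h4 : gridStep a₀ n / (1 + a₀) ≤ 1 - (1 + gridStep a₀ n)⁻¹ := by
    have e : 1 - (1 + gridStep a₀ n)⁻¹ = gridStep a₀ n / (1 + gridStep a₀ n) := by
      field_simp; ring
    rw [e]
    exact div_le_div_of_nonneg_left ha.le (by linarith) (by linarith [gridStep_le ha₀ hn])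
  have h5 : (j : ℝ) * (gridStep a₀ n / (1 + a₀)) ≤ 2 * Real.log n :=
    (mul_le_mul_of_nonneg_left (h4.trans h3) (by positivity)).trans (by exact_mod_cast h2)
  rw [gridStep] at h5
  have e : 2 * (1 + a₀) / a₀ * Real.log n ^ 2 =
      2 * Real.log n / (a₀ / Real.log n / (1 + a₀)) := by
    field_simp
  rw [e, le_div_iff₀ (by positivity)]
  exact h5

theorem bddAbove_exponents (hd : 0 < d) (ha₀ : 0 < a₀) (hn : 3 ≤ n) :
    ⌊2 * (1 + a₀) / a₀ * Real.log n ^ 2⌋₊ ∈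
      upperBounds {j : ℕ | minBandwidth d n * (1 + gridStep a₀ n) ^ j < 1} :=
  fun _ hj => Nat.le_floor (exponent_le hd ha₀ hn hj)

theorem gridSize_le (hd : 0 < d) (ha₀ : 0 < a₀) (hn : 3 ≤ n) :
    (gridSize d a₀ n : ℝ) ≤ 2 * (1 + a₀) / a₀ * Real.log n ^ 2 + 2 := by
  have h1 := csSup_le' (bddAbove_exponents (a₀ := a₀) hd ha₀ hn)
  have h2 : (⌊2 * (1 + a₀) / a₀ * Real.log n ^ 2⌋₊ : ℝ) ≤ 2 * (1 + a₀) / a₀ * Real.log n ^ 2 :=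
    Nat.floor_le (by positivity)
  have h3 : gridSize d a₀ n ≤ ⌊2 * (1 + a₀) / a₀ * Real.log n ^ 2⌋₊ + 2 :=
    Nat.add_le_add_right h1 2
  have h4 : (gridSize d a₀ n : ℝ) ≤ (⌊2 * (1 + a₀) / a₀ * Real.log n ^ 2⌋₊ : ℝ) + 2 := by
    exact_mod_cast h3
  linarith

theorem exists_bandwidth_eq_one (d : ℕ) (a₀ : ℝ) (n : ℕ) :
    ∃ j : Fin (gridSize d a₀ n), bandwidth d a₀ n j = 1 :=
  ⟨⟨gridSize d a₀ n - 1, by unfold gridSize; omega⟩, by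
    rw [bandwidth, if_pos]
    change gridSize d a₀ n - 1 + 1 = gridSize d a₀ n
    unfold gridSize
    omega⟩

theorem exists_bandwidth_near (hd : 0 < d) (ha₀ : 0 < a₀) (hn : 3 ≤ n) {h : ℝ}
    (hh : minBandwidth d n ≤ h) (hh1 : h < 1) :
    ∃ j : Fin (gridSize d a₀ n), bandwidth d a₀ n j ≤ h ∧
      h ≤ (1 + gridStep a₀ n) * bandwidth d a₀ n j := by
  have h0 := minBandwidth_pos (d := d) hn
  have ha := gridStep_pos ha₀ hn
  obtain ⟨i, hi1, hi2⟩ := exists_nat_pow_near ((one_le_div h0).2 hh)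
    (by linarith : 1 < 1 + gridStep a₀ n)
  rw [le_div_iff₀ h0] at hi1
  rw [div_lt_iff₀ h0] at hi2
  have hmem : i ∈ {j : ℕ | minBandwidth d n * (1 + gridStep a₀ n) ^ j < 1} := by
    rw [Set.mem_ofPred_eq, mul_comm]
    linarith
  have hle := le_csSup ⟨_, bddAbove_exponents hd ha₀ hn⟩ hmem
  have hlt : i < gridSize d a₀ n := by unfold gridSize; omega
  have hb : bandwidth d a₀ n ⟨i, hlt⟩ = (1 + gridStep a₀ n) ^ i * minBandwidth d n := by
    rw [bandwidth, if_neg]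
    change ¬ i + 1 = gridSize d a₀ n
    unfold gridSize
    omega
  refine ⟨⟨i, hlt⟩, hb ▸ hi1, ?_⟩
  rw [hb, ← mul_assoc, ← pow_succ']
  exact hi2.le

theorem trainSize_le (hn : 3 ≤ n) : (trainSize n : ℝ) ≤ n * (1 - (Real.log n)⁻¹) := by
  refine Nat.floor_le (mul_nonneg (by positivity) ?_)
  rw [sub_nonneg]
  exact inv_le_one_of_one_le₀ (one_le_log hn)

theorem trainSize_le_self (hn : 3 ≤ n) : trainSize n ≤ n := by
  have h1 := trainSize_le hn
  have h2 : 0 < (Real.log n)⁻¹ := inv_pos.2 (by linarith [one_le_log hn])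
  have h3 : (trainSize n : ℝ) ≤ n := h1.trans (mul_le_of_le_one_right (by positivity) (by linarith))
  exact_mod_cast h3

theorem le_validSize (hn : 3 ≤ n) : (n : ℝ) / Real.log n ≤ validSize n := by
  rw [validSize, Nat.cast_sub (trainSize_le_self hn), div_eq_mul_inv]
  linarith [trainSize_le hn]

theorem validSize_pos (hn : 3 ≤ n) : 0 < validSize n := by
  have h1 := le_validSize hn
  have h2 : 0 < (n : ℝ) / Real.log n :=
    div_pos (by positivity) (by linarith [one_le_log hn])
  exact_mod_cast h2.trans_le h1

end Grid

section Limits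

theorem tendsto_log_natCast : Tendsto (fun n : ℕ => Real.log n) atTop atTop :=
  Real.tendsto_log_atTop.comp tendsto_natCast_atTop_atTop

theorem tendsto_trainSize_div : Tendsto (fun n : ℕ => (trainSize n : ℝ) / n) atTop (𝓝 1) := by
  have hl : Tendsto (fun n : ℕ => 1 - (Real.log n)⁻¹) atTop (𝓝 1) := by
    simpa using (tendsto_inv_atTop_zero.comp tendsto_log_natCast).const_sub 1
  have hl2 : Tendsto (fun n : ℕ => 1 - (Real.log n)⁻¹ - (n : ℝ)⁻¹) atTop (𝓝 1) := by
    simpa using hl.sub (tendsto_inv_atTop_zero.comp tendsto_natCast_atTop_atTop)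
  refine tendsto_of_tendsto_of_tendsto_of_le_of_le' hl2 hl ?_ ?_
  · filter_upwards [eventually_ge_atTop 3] with n hn
    have hn0 : (0 : ℝ) < n := by positivity
    have h1 := (Nat.sub_one_lt_floor ((n : ℝ) * (1 - (Real.log n)⁻¹))).le
    rw [le_div_iff₀ hn0, trainSize]
    refine le_trans (le_of_eq ?_) h1
    rw [sub_mul, inv_mul_cancel₀ hn0.ne', mul_comm]
  · filter_upwards [eventually_ge_atTop 3] with n hn
    have hn0 : (0 : ℝ) < n := by positivity
    rw [div_le_iff₀ hn0, mul_comm]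
    exact trainSize_le hn

theorem tendsto_div_trainSize : Tendsto (fun n : ℕ => (n : ℝ) / trainSize n) atTop (𝓝 1) := by
  simpa using tendsto_trainSize_div.inv₀ one_ne_zero

theorem eventually_trainSize_pos : ∀ᶠ n in atTop, 0 < trainSize n := by
  filter_upwards [tendsto_trainSize_div.eventually (lt_mem_nhds one_pos)] with n hn
  by_contra! h
  simp [Nat.le_zero.1 h] at hn

theorem tendsto_one_add_gridStep_pow (a₀ : ℝ) (d : ℕ) :
    Tendsto (fun n => (1 + gridStep a₀ n) ^ d) atTop (𝓝 1) := by
  have h : Tendsto (fun n => gridStep a₀ n) atTop (𝓝 0) :=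
    tendsto_log_natCast.const_div_atTop a₀
  simpa using (h.const_add 1).pow d

theorem tendsto_log_pow_mul_rpow_neg {α : ℝ} (hα : 0 < α) (k : ℕ) :
    Tendsto (fun n : ℕ => Real.log n ^ k * (n : ℝ) ^ (-α)) atTop (𝓝 0) := by
  have h := (isLittleO_log_rpow_rpow_atTop (k : ℝ) hα).tendsto_div_nhds_zero.comp
    tendsto_natCast_atTop_atTop
  refine h.congr fun n => ?_
  simp only [Function.comp_apply, Real.rpow_natCast]
  rw [Real.rpow_neg (by positivity), div_eq_mul_inv]

end Limits

section Oracle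

variable {d : ℕ} {p K Φ : Pt d → ℝ} {L a₀ : ℝ}

/-- Some bandwidth of the grid does nearly as well as any given bandwidth. -/
theorem Assumptions.eventually_exists_bandwidth (H : Assumptions p K Φ L) (hd : 0 < d)
    (ha₀ : 0 < a₀) :
    ∀ᶠ n : ℕ in atTop, ∀ h : ℝ, 0 < h → ∃ j : Fin (gridSize d a₀ n),
      kdeRisk K p n (bandwidth d a₀ n j) ≤
        ENNReal.ofReal ((1 + gridStep a₀ n) ^ d) * kdeRisk K p n h +
        ENNReal.ofReal (((1 + gridStep a₀ n) ^ d * (∫ x, p x ^ 2) + ∫ z, K z ^ 2) / n) := by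
  have hκ : 0 ≤ ∫ z, K z ^ 2 := integral_nonneg fun _ => sq_nonneg _
  have hQ : 0 ≤ ∫ z, p z ^ 2 := integral_nonneg fun _ => sq_nonneg _
  have hlarge : ∀ᶠ n : ℕ in atTop, 0 < ∫ z, K z ^ 2 →
      2 * (∫ x, p x ^ 2) + (∫ z, K z ^ 2) ≤ (∫ z, K z ^ 2) * Real.log n := by
    rcases hκ.eq_or_lt with h0 | hpos
    · exact Eventually.of_forall fun n hn => absurd hn (by rw [← h0]; exact lt_irrefl _)
    · filter_upwards [(tendsto_log_natCast.const_mul_atTop hpos).eventually_ge_atTop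
        (2 * (∫ x, p x ^ 2) + (∫ z, K z ^ 2))] with n hn _
      exact hn
  filter_upwards [eventually_ge_atTop 3, hlarge] with n hn hbig h hh
  have hn0 : 0 < n := by omega
  have hnR : (0 : ℝ) < n := by exact_mod_cast hn0
  have hb : 1 ≤ 1 + gridStep a₀ n := by linarith [gridStep_pos ha₀ hn]
  have hbd : 1 ≤ (1 + gridStep a₀ n) ^ d := one_le_pow₀ hb
  have hinfl : kdeRisk K p n h ≤ ENNReal.ofReal ((1 + gridStep a₀ n) ^ d) * kdeRisk K p n h := by
    refine le_mul_of_one_le_left zero_le ?_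
    rw [ENNReal.one_le_ofReal]
    exact hbd
  obtain ⟨j₁, hj₁⟩ := exists_bandwidth_eq_one d a₀ n
  rcases lt_or_ge h (minBandwidth d n) with hsmall | hge
  · refine ⟨j₁, ?_⟩
    rw [hj₁]
    refine le_trans ?_ (hinfl.trans le_self_add)
    rcases hκ.eq_or_lt with h0 | hpos
    · exact (kdeRisk_eq_of_integral_sq_eq_zero H.memLp h0.symm n one_pos hh).le
    · refine H.kdeRisk_one_le_of_small hn0 hh (Λ := Real.log n) ?_ (hbig hpos)
      rw [← inv_minBandwidth_pow hd hn]
      exact inv_anti₀ (pow_pos hh d) (pow_le_pow_left₀ hh.le hsmall.le d)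
  rcases lt_or_ge h 1 with hlt | hge1
  · obtain ⟨j, hj1, hj2⟩ := exists_bandwidth_near hd ha₀ hn hge hlt
    refine ⟨j, (H.kdeRisk_le_of_le hn0 (bandwidth_pos ha₀ hn j) hj1 hb hj2).trans ?_⟩
    gcongr
    linarith
  · refine ⟨j₁, ?_⟩
    rw [hj₁]
    refine (H.kdeRisk_one_le_of_one_le hn0 hge1).trans (add_le_add hinfl ?_)
    refine ENNReal.ofReal_le_ofReal ?_
    gcongr
    nlinarith

end Oracle

section Remainder

variable {d : ℕ} {L a₀ α c : ℝ}

/-- The inflation factor in the oracle inequality. -/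
def inflation (d : ℕ) (a₀ : ℝ) (n : ℕ) : ℝ :=
  (n : ℝ) / trainSize n * (1 + gridStep a₀ n) ^ d

/-- The remainder in the oracle inequality. -/
def remainder (d : ℕ) (a₀ L Q κ : ℝ) (n : ℕ) : ℝ :=
  (n : ℝ) / trainSize n * (((1 + gridStep a₀ n) ^ d * Q + κ) / n) +
    L * gridSize d a₀ n / validSize n

theorem tendsto_inflation (d : ℕ) (a₀ : ℝ) : Tendsto (inflation d a₀) atTop (𝓝 1) := by
  have h := tendsto_div_trainSize.mul (tendsto_one_add_gridStep_pow a₀ d)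
  rw [mul_one] at h
  exact h

/-- The remainder, relative to the lower bound on the oracle risk. -/
def relRemainder (d : ℕ) (a₀ L Q κ c α : ℝ) (n : ℕ) : ℝ :=
  ((n : ℝ) / trainSize n * ((1 + gridStep a₀ n) ^ d * Q + κ) * (n : ℝ) ^ (-α) +
    L * (2 * (1 + a₀) / a₀ * (Real.log n ^ 3 * (n : ℝ) ^ (-α)) +
      2 * (Real.log n ^ 1 * (n : ℝ) ^ (-α)))) / c

theorem tendsto_relRemainder (d : ℕ) (a₀ L Q κ c : ℝ) (hα : 0 < α) :
    Tendsto (relRemainder d a₀ L Q κ c α) atTop (𝓝 0) := by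
  have h0 : Tendsto (fun n : ℕ => (n : ℝ) ^ (-α)) atTop (𝓝 0) := by
    simpa using tendsto_log_pow_mul_rpow_neg hα 0
  have h1 := (tendsto_div_trainSize.mul
    (((tendsto_one_add_gridStep_pow a₀ d).mul_const Q).add_const κ)).mul h0
  have h2 := (((tendsto_log_pow_mul_rpow_neg hα 3).const_mul (2 * (1 + a₀) / a₀)).add
    ((tendsto_log_pow_mul_rpow_neg hα 1).const_mul 2)).const_mul L
  have h3 := (h1.add h2).div_const c
  simp only [mul_zero, add_zero, zero_div] at h3
  exact h3

theorem remainder_le (hd : 0 < d) (ha₀ : 0 < a₀) (hL : 0 ≤ L) (hc : 0 < c) (Q κ : ℝ) {n : ℕ}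
    (hn : 3 ≤ n) :
    remainder d a₀ L Q κ n ≤ relRemainder d a₀ L Q κ c α n * (c * (n : ℝ) ^ (-1 + α)) := by
  have hn0 : (0 : ℝ) < n := by positivity
  have hlg := one_le_log hn
  have hα : (n : ℝ) ^ (-α) * (n : ℝ) ^ (-1 + α) = (n : ℝ)⁻¹ := by
    rw [← Real.rpow_add hn0, ← Real.rpow_neg_one]
    congr 1
    ring
  have h1 : L * gridSize d a₀ n / validSize n ≤
      L * (2 * (1 + a₀) / a₀ * Real.log n ^ 3 + 2 * Real.log n) * (n : ℝ)⁻¹ := by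
    have h2 := gridSize_le hd ha₀ hn
    have h3 := le_validSize hn
    have h4 : 0 < (n : ℝ) / Real.log n := div_pos hn0 (by linarith)
    calc L * gridSize d a₀ n / validSize n
        ≤ L * (2 * (1 + a₀) / a₀ * Real.log n ^ 2 + 2) / (n / Real.log n) := by gcongr
      _ = _ := by
        have : Real.log n ≠ 0 := by positivity
        field_simp
  have h5 : relRemainder d a₀ L Q κ c α n * (c * (n : ℝ) ^ (-1 + α)) =
      ((n : ℝ) / trainSize n * ((1 + gridStep a₀ n) ^ d * Q + κ) +
        L * (2 * (1 + a₀) / a₀ * Real.log n ^ 3 + 2 * Real.log n)) *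
        ((n : ℝ) ^ (-α) * (n : ℝ) ^ (-1 + α)) := by
    unfold relRemainder
    field_simp
  rw [h5, hα, remainder, add_mul, ← mul_div_assoc, div_eq_mul_inv _ (n : ℝ)]
  linarith

end Remainder

section Oracle

variable {d : ℕ} {p K Φ : Pt d → ℝ} {L a₀ : ℝ}

/-- The oracle inequality for the averaged kernel aggregate, with explicit constants. -/
theorem Assumptions.eventually_risk_averaged_le (H : Assumptions p K Φ L) (hd : 0 < d)
    (hL : 0 ≤ L) (ha₀ : 0 < a₀) {kind : Kind} {𝒮 : ∀ n : ℕ, Finset (Split n)}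
    (h𝒮 : ∀ n, 3 ≤ n → (𝒮 n).Nonempty)
    {T : ∀ n : ℕ, Split n → (Fin (trainSize n) → Pt d) → (Fin (validSize n) → Pt d) → Pt d → ℝ}
    (hT : ∀ n, 3 ≤ n → ∀ S ∈ 𝒮 n, IsSplitAggregate kind K p a₀ n (T n S)) :
    ∀ᶠ n : ℕ in atTop, risk (averaged (𝒮 n) (T n)) p ≤
      ENNReal.ofReal (inflation d a₀ n) * oracleRisk K p n +
        ENNReal.ofReal (remainder d a₀ L (∫ x, p x ^ 2) (∫ z, K z ^ 2) n) := by
  have hκ : 0 ≤ ∫ z, K z ^ 2 := integral_nonneg fun _ => sq_nonneg _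
  have hQ : 0 ≤ ∫ z, p z ^ 2 := integral_nonneg fun _ => sq_nonneg _
  filter_upwards [eventually_ge_atTop 3, eventually_trainSize_pos,
    H.eventually_exists_bandwidth hd ha₀] with n hn hm hbw
  have hb : 0 ≤ 1 + gridStep a₀ n := by linarith [gridStep_pos ha₀ hn]
  have hpt : ∀ h : Set.Ioi (0 : ℝ), risk (averaged (𝒮 n) (T n)) p ≤
      ENNReal.ofReal (inflation d a₀ n) * risk (fun X : Fin n → Pt d => kde K h X) p +
        ENNReal.ofReal (remainder d a₀ L (∫ x, p x ^ 2) (∫ z, K z ^ 2) n) := by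
    intro h
    obtain ⟨j, hj⟩ := hbw h h.2
    have h1 := risk_averaged_le H.density H.le_bound hL H.memLp (bandwidth_pos ha₀ hn)
      (validSize_pos hn) (h𝒮 n hn) (hT n hn) j
    have h2 := H.kdeRisk_sampleSize hm (trainSize_le_self hn) (bandwidth_pos ha₀ hn j)
    refine h1.trans ((add_le_add_left (h2.trans (mul_le_mul_right hj _)) _).trans (le_of_eq ?_))
    rw [mul_add, ← mul_assoc, ← ENNReal.ofReal_mul (by positivity),
      ← ENNReal.ofReal_mul (by positivity), add_assoc,
      ← ENNReal.ofReal_add (by positivity) (by positivity)]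
    rfl
  have hne : Nonempty (Set.Ioi (0 : ℝ)) := ⟨⟨1, Set.mem_Ioi.2 one_pos⟩⟩
  rw [oracleRisk, ENNReal.mul_iInf_of_ne, ENNReal.iInf_add]
  · exact le_iInf hpt
  · have : 0 < inflation d a₀ n := by
      unfold inflation
      have := gridStep_pos ha₀ hn
      positivity
    simpa using this
  · exact ENNReal.ofReal_ne_top

end Oracle

end KernelAgg

end

theorem corollary5p1 {d : ℕ} (hd : 0 < d)
    -- a bounded density
    (p : KernelAgg.Pt d → ℝ) (hp : KernelAgg.IsDensity p)
    (L : ℝ) (hL : 0 < L) (hpL : eLpNorm p ∞ volume ≤ ENNReal.ofReal L)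
    -- the kernel
    (K : KernelAgg.Pt d → ℝ) (hK : MemLp K 2 volume)
    (Φ : KernelAgg.Pt d → ℝ) (hΦ : KernelAgg.IsFourierVersion K hK Φ)
    (hΦ01 : ∀ t, Φ t ∈ Set.Icc (0 : ℝ) 1)
    (hΦmono : ∀ (t : KernelAgg.Pt d) (h h' : ℝ), 0 < h' → h' < h → Φ (h • t) ≤ Φ (h' • t))
    -- the averaged linear or convex kernel aggregates
    (a₀ : ℝ) (ha₀ : 0 < a₀) (kind : KernelAgg.Kind)
    (𝒮 : ∀ n : ℕ, Finset (KernelAgg.Split n)) (h𝒮 : ∀ n, 3 ≤ n → (𝒮 n).Nonempty)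
    (T : ∀ n : ℕ, KernelAgg.Split n → (Fin (KernelAgg.trainSize n) → KernelAgg.Pt d) →
      (Fin (KernelAgg.validSize n) → KernelAgg.Pt d) → KernelAgg.Pt d → ℝ)
    (hT : ∀ n, 3 ≤ n → ∀ S ∈ 𝒮 n, KernelAgg.IsSplitAggregate kind K p a₀ n (T n S))
    -- the lower bound on the oracle risk
    (c α : ℝ) (hc : 0 < c) (hα : 0 < α)
    (horacle : ∀ᶠ n : ℕ in atTop,
      ENNReal.ofReal (c * (n : ℝ) ^ (-1 + α)) ≤ KernelAgg.oracleRisk K p n) :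
    ∃ ε : ℕ → ℝ≥0, Tendsto ε atTop (𝓝 0) ∧
      ∀ᶠ n : ℕ in atTop,
        KernelAgg.risk (KernelAgg.averaged (𝒮 n) (T n)) p ≤
          KernelAgg.oracleRisk K p n * (1 + (ε n : ℝ≥0∞)) := by
  have H : KernelAgg.Assumptions p K Φ L :=
    ⟨hp, KernelAgg.ae_le_of_eLpNorm_top_le hL hpL, hK, hΦ, hΦ01, hΦmono⟩
  have hmain := H.eventually_risk_averaged_le hd hL.le ha₀ h𝒮 hT
  set A := KernelAgg.inflation d a₀
  set δ := KernelAgg.relRemainder d a₀ L (∫ x, p x ^ 2) (∫ z, K z ^ 2) c α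
  have hA : Tendsto A atTop (𝓝 1) := KernelAgg.tendsto_inflation d a₀
  have hδ : Tendsto δ atTop (𝓝 0) :=
    KernelAgg.tendsto_relRemainder d a₀ L (∫ x, p x ^ 2) (∫ z, K z ^ 2) c hα
  refine ⟨fun n => Real.toNNReal (A n - 1) + Real.toNNReal (δ n), ?_, ?_⟩
  · have h1 : Tendsto (fun n => A n - 1) atTop (𝓝 0) := by simpa using hA.sub_const 1
    simpa using (tendsto_real_toNNReal h1).add (tendsto_real_toNNReal hδ)
  · filter_upwards [hmain, horacle, eventually_ge_atTop 3] with n hn hlow hn3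
    have hrem : ENNReal.ofReal (KernelAgg.remainder d a₀ L (∫ x, p x ^ 2) (∫ z, K z ^ 2) n) ≤
        ENNReal.ofReal (δ n) * KernelAgg.oracleRisk K p n := by
      refine (ENNReal.ofReal_le_ofReal
        (KernelAgg.remainder_le (α := α) hd ha₀ hL.le hc _ _ hn3)).trans ?_
      rw [ENNReal.ofReal_mul' (by positivity)]
      exact mul_le_mul_right hlow _
    have hinfl : ENNReal.ofReal (A n) ≤ 1 + ENNReal.ofReal (A n - 1) := by
      have := ENNReal.ofReal_add_le (p := 1) (q := A n - 1)
      simpa using this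
    calc _ ≤ _ := hn
      _ ≤ (1 + ENNReal.ofReal (A n - 1)) * KernelAgg.oracleRisk K p n +
          ENNReal.ofReal (δ n) * KernelAgg.oracleRisk K p n :=
        add_le_add (mul_le_mul_left hinfl _) hrem
      _ = _ := by
        rw [← add_mul, mul_comm, add_assoc]
        simp only [ENNReal.coe_add]
        rfl
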